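/- **Square-root lower bound on the entangling time of a qubit chain.** Consider an open chain of $L\ge 2$ qubits with Hilbert space $(\mathbb C^2)^{\otimes L}$ and time-dependent nearest-neighbour Hamiltonian $$H(t)=\sum_{i=1}^{L}K_i(t)+\sum_{i=1}^{L-1}h_{i,i+1}(t),$$ where $K_i(t)$ is a Hermitian operator on qubit $i$ (arbitrarily strong local control), $h_{i,i+1}(t)$ is a Hermitian operator on qubits $i,i+1$ of strength at most one, $\|h_{i,i+1}(t)\|_{\mathrm{HS}}=\sqrt{\operatorname{tr}h_{i,i+1}(t)^2}\le 1$ (in particular, all strengths may be equal to $1$), and all matrix entries are integrable functions of $t\in[0,T]$. Let $\psi:[0,T]\to(\mathbb C^2)^{\otimes L}$ be continuous with $$\psi(t)=\psi(0)-i\int_0^t H(s)\psi(s)\,ds\qquad(0\le t\le T),$$ and suppose that $\psi(0)$ is a product of one-qubit unit vectors. Let $\rho_{1L}(t)$ be the reduced state of the two end qubits (the partial trace of $|\psi(t)\rangle\langle\psi(t)|$ over all other qubits), and let the singlet fraction of a two-qubit state $\rho$ be $F(\rho)=\max_{\phi}\langle\phi|\rho|\phi\rangle$, the maximum being over all two-qubit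 vectors $\phi$ both of whose one-qubit reduced states are $\tfrac12\mathbb 1$. Then there is a universal $L_0$ such that, for every $L\ge L_0$, every $T\ge0$ and every such evolution, if the end qubits are maximally entangled at time $T$, i.e. $F(\rho_{1L}(T))=1$, then $$T\ \ge\ \sqrt{\frac{\lfloor L/2\rfloor}{2}} .$$ In other words, the entangling time satisfies $T_{\mathrm{ent}}\ge\sqrt{\lfloor L/2\rfloor/2}$ for all sufficiently large $L$, uniformly in the couplings, the local controls and the initial product state. -/

import Mathlib

/-! Qubits indexed by a type `ι`. The computational basis of their Hilbert space is `ι → Fin 2`;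
state vectors are functions `(ι → Fin 2) → ℂ`, operators are square matrices over `ι → Fin 2`. -/

noncomputable section

namespace QubitChain

/-- The computational basis configurations of qubits indexed by `ι`. -/
abbrev Config (ι : Type*) : Type _ := ι → Fin 2

/-- State vectors of qubits indexed by `ι`. -/
abbrev StateVec (ι : Type*) : Type _ := Config ι → ℂ

/-- Operators on qubits indexed by `ι`. -/
abbrev Op (ι : Type*) : Type _ := Matrix (Config ι) (Config ι) ℂ

open Classical in
/-- The operator `M ⊗ 1`, where `M` acts on the qubits picked out by the injection `f : κ → ι`
and the identity acts on all other qubits. -/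
def embedOp {κ ι : Type*} (f : κ → ι) (M : Op κ) : Op ι :=
  Matrix.of fun x y => if ∀ j, j ∉ Set.range f → x j = y j then M (x ∘ f) (y ∘ f) else 0

open Classical in
/-- The reduced density matrix on the qubits picked out by the injection `f : κ → ι`,
i.e. the partial trace over all other qubits. -/
def partialTrace {κ ι : Type*} [Fintype ι] [DecidableEq ι] (f : κ → ι) (ρ : Op ι) : Op κ :=
  Matrix.of fun a b => ∑ x : Config ι, ∑ y : Config ι,
    if x ∘ f = a ∧ y ∘ f = b ∧ ∀ j, j ∉ Set.range f → x j = y j then ρ x y else 0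

/-- The pure-state density matrix `|ψ⟩⟨ψ|`. -/
def density {ι : Type*} (ψ : StateVec ι) : Op ι := Matrix.vecMulVec ψ (star ψ)

/-- A completely separable pure state: a tensor product of one-qubit unit vectors. -/
def IsProductState {ι : Type*} [Fintype ι] (ψ : StateVec ι) : Prop :=
  ∃ v : ι → Fin 2 → ℂ, (∀ i, ∑ s, ‖v i s‖ ^ 2 = 1) ∧ ∀ x, ψ x = ∏ i, v i (x i)

/-- The Hilbert-Schmidt norm `√(tr (M† M)) = √(∑ |M a b|²)`. -/
def hsNorm {n : Type*} [Fintype n] (M : Matrix n n ℂ) : ℝ :=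
  Real.sqrt (∑ a, ∑ b, ‖M a b‖ ^ 2)

/-- A two-qubit vector is maximally entangled if both of its one-qubit reduced states are
maximally mixed (so that, in particular, it is a unit vector). -/
def IsMaxEntangled (φ : StateVec (Fin 2)) : Prop :=
  ∀ q : Fin 2, partialTrace (fun _ : Fin 1 => q) (density φ) = (1 / 2 : ℂ) • 1

/-- The singlet fraction of a two-qubit state: the maximum of `⟨φ|ρ|φ⟩` over all maximally
entangled two-qubit vectors `φ`. -/
def singletFraction (ρ : Op (Fin 2)) : ℝ :=
  sSup {r : ℝ | ∃ φ : StateVec (Fin 2), IsMaxEntangled φ ∧ r = (star φ ⬝ᵥ (ρ.mulVec φ)).re}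

/-- The left site of the `i`-th link of an open chain of `L` sites. -/
def linkLeft {L : ℕ} (i : Fin (L - 1)) : Fin L := ⟨i, by omega⟩

/-- The right site of the `i`-th link of an open chain of `L` sites. -/
def linkRight {L : ℕ} (i : Fin (L - 1)) : Fin L := ⟨i + 1, by omega⟩

/-- The two end sites of a chain of `L ≥ 2` sites. -/
def ends {L : ℕ} (hL : 2 ≤ L) : Fin 2 → Fin L := ![⟨0, by omega⟩, ⟨L - 1, by omega⟩]

/-- The nearest-neighbour Hamiltonian of an open chain of `L` qubits with one-qubit terms `K i`
on the sites and interactions `h i` on the links. -/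
def chainHamiltonian {L : ℕ} (K : Fin L → Op (Fin 1)) (h : Fin (L - 1) → Op (Fin 2)) :
    Op (Fin L) :=
  ∑ i, embedOp (fun _ => i) (K i) + ∑ i, embedOp ![linkLeft i, linkRight i] (h i)

/-- The trajectory `ψ` of a chain of `L` qubits on the time interval `[0, T]` under the
time-dependent nearest-neighbour Hamiltonian with one-qubit terms `K` (arbitrary integrable local
controls) and interactions `h`, all of strength at most `1`.  The Schrödinger equation
`ψ' = -i H(t) ψ` is imposed in integrated form, which allows interactions and controls that are
switched discontinuously. -/
structure IsUnitChainEvolution (L : ℕ) (T : ℝ) (K : Fin L → ℝ → Op (Fin 1))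
    (h : Fin (L - 1) → ℝ → Op (Fin 2)) (ψ : ℝ → StateVec (Fin L)) : Prop where
  local_hermitian : ∀ i, ∀ t ∈ Set.Icc 0 T, (K i t).IsHermitian
  local_integrable : ∀ i a b,
    IntervalIntegrable (fun t => K i t a b) MeasureTheory.volume 0 T
  link_hermitian : ∀ i, ∀ t ∈ Set.Icc 0 T, (h i t).IsHermitian
  link_integrable : ∀ i a b,
    IntervalIntegrable (fun t => h i t a b) MeasureTheory.volume 0 T
  link_strength : ∀ i, ∀ t ∈ Set.Icc 0 T, hsNorm (h i t) ≤ 1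
  continuous : ContinuousOn ψ (Set.Icc 0 T)
  schrodinger : ∀ t ∈ Set.Icc 0 T, ∀ x, ψ t x = ψ 0 x - Complex.I *
    ∫ s in (0 : ℝ)..t, (chainHamiltonian (fun i => K i s) (fun i => h i s)).mulVec (ψ s) x

end QubitChain

end

/-! The bound is a Lieb–Robinson estimate for correlations across the middle of the chain. Let `A`
be the left half, let `E_s` be the Frobenius-orthogonal projection onto the operators supported on
`s` (partial trace, then tensoring with the maximally mixed state), and put C = ρ - 2^L E_A(ρ)
E_{Aᶜ}(ρ) = ρ - ρ_A ⊗ ρ_{Aᶜ} for ρ = |ψ⟩⟨ψ|. Let n_k be the norm of E_s(C), where `s` consists of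
the k sites at each end.

For k < ⌊L/2⌋, consider the contribution of each term of H to (n_k²)'. A term inside `s` rotates
E_s(C) unitarily and contributes nothing, so arbitrarily strong local fields are harmless. A term
disjoint from `s` is invisible after E_s, even when it is the link across the middle that creates
the correlations (`inner_corrDeriv_commutator_of_disjoint`). Only the two links at the boundary of
`s` remain, and they lie within `A` or within its complement, where C evolves by a plain commutator.
Hence (n_k²)' ≤ 8 n_k n_{k+1} (`corrRate_chainHamiltonian_le`). A product state has C = 0, so
starting from the trivial bound n_{⌊L/2⌋} ≤ 1 + 2^L, iterated integration gives n_{⌊L/2⌋-j}(t) ≤ (1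
+ 2^L)(8t)^j / j! (`norm_corr_outer_le`).

Conversely, if the ends have singlet fraction 1, some maximally entangled φ has overlap above 3/4
with the end state, while product states overlap φ by at most 1/2. Testing C against |φ⟩⟨φ| ⊗ 1
forces 2^L n_1 ≥ 1/4 (`le_norm_corr_of_singletFraction`). With j = ⌊L/2⌋ - 1 and T at most √(j+1),
the factorial beats all factors exponential in L (`bound_lt_quarter`), a contradiction. The square
root is far from the limit of this estimate, so constants are treated crudely. -/

noncomputable section

namespace QubitChain

open MeasureTheory
open scoped Matrix.Norms.Frobenius

/-! ### Frobenius geometry and conditional expectations. -/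

section Frobenius

variable {n : Type*} [Fintype n]

/-- The Frobenius inner product `tr (X† Y)` on square matrices. -/
instance frobeniusInnerProductSpace : InnerProductSpace ℂ (Matrix n n ℂ) where
  inner X Y := (X.conjTranspose * Y).trace
  norm_sq_eq_re_inner X := by
    have h : (X.conjTranspose * X).trace = ((∑ i, ∑ j, ‖X i j‖ ^ 2 : ℝ) : ℂ) := by
      rw [Finset.sum_comm]
      simp only [Matrix.trace, Matrix.diag_apply, Matrix.mul_apply, Matrix.conjTranspose_apply]
      push_cast
      refine Finset.sum_congr rfl fun i _ => Finset.sum_congr rfl fun j _ => ?_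
      rw [RCLike.star_def, Complex.conj_mul']
    rw [h, Matrix.frobenius_norm_def, ← Real.sqrt_eq_rpow]
    simp only [Real.rpow_two]
    rw [Real.sq_sqrt (by positivity)]
    exact (Complex.ofReal_re _).symm
  conj_inner_symm X Y := by
    rw [starRingEnd_apply, ← Matrix.trace_conjTranspose, Matrix.conjTranspose_mul,
      Matrix.conjTranspose_conjTranspose]
  add_left X Y Z := by
    rw [Matrix.conjTranspose_add, Matrix.add_mul, Matrix.trace_add]
  smul_left X Y r := by
    rw [Matrix.conjTranspose_smul, Matrix.smul_mul, Matrix.trace_smul, smul_eq_mul,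
      starRingEnd_apply]

theorem inner_eq_trace (X Y : Matrix n n ℂ) : inner ℂ X Y = (star X * Y).trace := rfl

theorem norm_sq_eq_sum (X : Matrix n n ℂ) : ‖X‖ ^ 2 = ∑ i, ∑ j, ‖X i j‖ ^ 2 := by
  rw [Matrix.frobenius_norm_def, ← Real.sqrt_eq_rpow]
  simp only [Real.rpow_two]
  rw [Real.sq_sqrt (by positivity)]

theorem hsNorm_eq_norm (X : Matrix n n ℂ) : hsNorm X = ‖X‖ := by
  rw [hsNorm, ← norm_sq_eq_sum, Real.sqrt_sq (norm_nonneg _)]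

theorem frobenius_norm_star (X : Matrix n n ℂ) : ‖star X‖ = ‖X‖ :=
  Matrix.frobenius_norm_conjTranspose X

theorem inner_self_eq (X : Matrix n n ℂ) : inner ℂ X X = ((‖X‖ ^ 2 : ℝ) : ℂ) := by
  rw [inner_self_eq_norm_sq_to_K]
  push_cast
  rfl

theorem inner_mul_left_eq (a X Y : Matrix n n ℂ) :
    inner ℂ (a * X) Y = inner ℂ X (star a * Y) := by
  simp only [inner_eq_trace, star_mul, mul_assoc]

theorem inner_mul_right_eq (a X Y : Matrix n n ℂ) :
    inner ℂ (X * a) Y = inner ℂ X (Y * star a) := by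
  simp only [inner_eq_trace, star_mul]
  rw [mul_assoc, Matrix.trace_mul_comm, mul_assoc]

/-- The commutator with a Hermitian matrix is symmetric for the Frobenius inner product. -/
theorem inner_commutator {a : Matrix n n ℂ} (ha : star a = a) (X Y : Matrix n n ℂ) :
    inner ℂ (a * X - X * a) Y = inner ℂ X (a * Y - Y * a) := by
  rw [inner_sub_left, inner_sub_right, inner_mul_left_eq, inner_mul_right_eq, ha]

theorem inner_commutator_self_im {a : Matrix n n ℂ} (ha : star a = a) (X : Matrix n n ℂ) :
    (inner ℂ X (a * X - X * a)).im = 0 := by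
  have h := inner_commutator ha X X
  rw [← inner_conj_symm] at h
  have := congrArg Complex.im h
  simp only [Complex.conj_im] at this
  linarith

/-- Moving `a` across the inner product from either side gives the same operator on `W`; thus `W`
does not see commutators with `a`. -/
theorem inner_mul_comm_of_commute {a W : Matrix n n ℂ} (h : star a * W = W * star a)
    (X : Matrix n n ℂ) : inner ℂ W (a * X) = inner ℂ W (X * a) := by
  have h1 := inner_mul_left_eq (star a) W X
  have h2 := inner_mul_right_eq (star a) W X
  rw [star_star] at h1 h2
  rw [← h1, ← h2, h]

variable [DecidableEq n] (S : StarSubalgebra ℂ (Matrix n n ℂ))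

/-- The conditional expectation onto a star subalgebra: the orthogonal projection for the
Frobenius inner product. -/
def condExp : Matrix n n ℂ →L[ℂ] Matrix n n ℂ := S.toSubalgebra.toSubmodule.starProjection

variable {S}

theorem condExp_mem (X : Matrix n n ℂ) : condExp S X ∈ S :=
  Submodule.starProjection_apply_mem S.toSubalgebra.toSubmodule X

theorem norm_condExp_le (X : Matrix n n ℂ) : ‖condExp S X‖ ≤ ‖X‖ :=
  Submodule.norm_starProjection_apply_le _ X

theorem inner_condExp {W : Matrix n n ℂ} (hW : W ∈ S) (X : Matrix n n ℂ) :
    inner ℂ W (condExp S X) = inner ℂ W X := by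
  have h := Submodule.starProjection_inner_eq_zero (K := S.toSubalgebra.toSubmodule) X W hW
  have h' := inner_eq_zero_symm.1 h
  rw [inner_sub_right, sub_eq_zero] at h'
  exact h'.symm

theorem inner_condExp_left (X Y : Matrix n n ℂ) :
    inner ℂ (condExp S X) Y = inner ℂ X (condExp S Y) :=
  Submodule.inner_starProjection_left_eq_right S.toSubalgebra.toSubmodule X Y

theorem condExp_eq_of_inner {X Y : Matrix n n ℂ} (hY : Y ∈ S)
    (h : ∀ W ∈ S, inner ℂ W Y = inner ℂ W X) : condExp S X = Y := by
  refine Submodule.eq_starProjection_of_mem_of_inner_eq_zero hY fun W hW => ?_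
  refine inner_eq_zero_symm.1 ?_
  rw [inner_sub_right, sub_eq_zero]
  exact (h W hW).symm

/-- Tested against `W` in `S`, the factor `a` moves to `star a * W`, which is again in `S` because
`S` is a star subalgebra. -/
theorem condExp_mul_left {a : Matrix n n ℂ} (ha : a ∈ S) (X : Matrix n n ℂ) :
    condExp S (a * X) = a * condExp S X := by
  refine condExp_eq_of_inner (mul_mem ha (condExp_mem X)) fun W hW => ?_
  have h1 := inner_mul_left_eq (star a) W (condExp S X)
  have h2 := inner_mul_left_eq (star a) W X
  rw [star_star] at h1 h2
  rw [← h1, ← h2, inner_condExp (mul_mem (star_mem ha) hW)]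

theorem condExp_mul_right {a : Matrix n n ℂ} (ha : a ∈ S) (X : Matrix n n ℂ) :
    condExp S (X * a) = condExp S X * a := by
  refine condExp_eq_of_inner (mul_mem (condExp_mem X) ha) fun W hW => ?_
  have h1 := inner_mul_right_eq (star a) W (condExp S X)
  have h2 := inner_mul_right_eq (star a) W X
  rw [star_star] at h1 h2
  rw [← h1, ← h2, inner_condExp (mul_mem hW (star_mem ha))]

/-- This is the cyclicity of the partial trace for operators on the qubits that are traced out. -/
theorem condExp_mul_comm {a : Matrix n n ℂ} (ha : ∀ W ∈ S, star a * W = W * star a)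
    (X : Matrix n n ℂ) : condExp S (a * X) = condExp S (X * a) := by
  refine condExp_eq_of_inner (condExp_mem _) fun W hW => ?_
  rw [inner_condExp hW, inner_mul_comm_of_commute (ha W hW)]

theorem condExp_commutator_of_mem {a : Matrix n n ℂ} (ha : a ∈ S) (X : Matrix n n ℂ) :
    condExp S (a * X - X * a) = a * condExp S X - condExp S X * a := by
  rw [map_sub, condExp_mul_left ha, condExp_mul_right ha]

theorem condExp_commutator_of_commute {a : Matrix n n ℂ}
    (ha : ∀ W ∈ S, star a * W = W * star a) (X : Matrix n n ℂ) :
    condExp S (a * X - X * a) = 0 := by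
  rw [map_sub, condExp_mul_comm ha, sub_self]

end Frobenius

/-! ### Tensor products, local algebras and independence. -/

section Tensor

variable {ι : Type*} [Fintype ι]

/-- The tensor product of one-qubit operators. -/
def tensorOp (q : ι → Matrix (Fin 2) (Fin 2) ℂ) : Op ι :=
  Matrix.of fun x y => ∏ i, q i (x i) (y i)

theorem tensorOp_apply (q : ι → Matrix (Fin 2) (Fin 2) ℂ) (x y : Config ι) :
    tensorOp q x y = ∏ i, q i (x i) (y i) := rfl

theorem star_tensorOp (q : ι → Matrix (Fin 2) (Fin 2) ℂ) :
    star (tensorOp q) = tensorOp (star q) := by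
  ext x y
  simp [tensorOp_apply, Matrix.star_apply]

theorem tensorOp_smul (c : ι → ℂ) (q : ι → Matrix (Fin 2) (Fin 2) ℂ) :
    tensorOp (fun i => c i • q i) = (∏ i, c i) • tensorOp q := by
  ext x y
  simp [tensorOp_apply, Finset.prod_mul_distrib]

theorem tensorOp_one : tensorOp (1 : ι → Matrix (Fin 2) (Fin 2) ℂ) = 1 := by
  ext x y
  rw [tensorOp_apply]
  by_cases h : x = y
  · subst h
    simp
  · obtain ⟨i, hi⟩ := Function.ne_iff.1 h
    rw [Matrix.one_apply_ne h]
    exact Finset.prod_eq_zero (Finset.mem_univ i) (by simp [Matrix.one_apply_ne hi])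

theorem single_eq_tensorOp (x y : Config ι) :
    Matrix.single x y (1 : ℂ) = tensorOp fun i => Matrix.single (x i) (y i) 1 := by
  ext a b
  rw [tensorOp_apply]
  by_cases h : x = a ∧ y = b
  · obtain ⟨rfl, rfl⟩ := h
    simp
  · rw [Matrix.single_apply_of_ne _ _ _ _ _ h]
    simp only [not_and_or, ← Ne.eq_def, Function.ne_iff] at h
    obtain ⟨i, hi⟩ | ⟨i, hi⟩ := h
    · exact (Finset.prod_eq_zero (Finset.mem_univ i) (by
        rw [Matrix.single_apply_of_ne]; exact fun h => hi h.1)).symm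
    · exact (Finset.prod_eq_zero (Finset.mem_univ i) (by
        rw [Matrix.single_apply_of_ne]; exact fun h => hi h.2)).symm

variable [DecidableEq ι]

theorem tensorOp_mul (p q : ι → Matrix (Fin 2) (Fin 2) ℂ) :
    tensorOp p * tensorOp q = tensorOp (p * q) := by
  ext x y
  simp only [tensorOp_apply, Matrix.mul_apply, Pi.mul_apply]
  rw [Finset.prod_univ_sum, Fintype.piFinset_univ]
  exact Finset.sum_congr rfl fun z _ => Finset.prod_mul_distrib.symm

theorem trace_tensorOp (q : ι → Matrix (Fin 2) (Fin 2) ℂ) :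
    (tensorOp q).trace = ∏ i, (q i).trace := by
  simp only [Matrix.trace, Matrix.diag_apply, tensorOp_apply]
  rw [Finset.prod_univ_sum, Fintype.piFinset_univ]

/-- The operator `u` acting on the qubit `i`. -/
def siteOp (i : ι) (u : Matrix (Fin 2) (Fin 2) ℂ) : Op ι := tensorOp (Pi.mulSingle i u)

theorem siteOp_mul (i : ι) (u v : Matrix (Fin 2) (Fin 2) ℂ) :
    siteOp i u * siteOp i v = siteOp i (u * v) := by
  rw [siteOp, siteOp, siteOp, tensorOp_mul, Pi.mulSingle_mul]

theorem siteOp_apply (i : ι) (u : Matrix (Fin 2) (Fin 2) ℂ) (x y : Config ι) :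
    siteOp i u x y = u (x i) (y i) * ∏ j ∈ Finset.univ.erase i, (1 : Matrix _ _ ℂ) (x j) (y j) := by
  rw [siteOp, tensorOp_apply, ← Finset.mul_prod_erase _ _ (Finset.mem_univ i)]
  congr 1
  · simp
  · refine Finset.prod_congr rfl fun j hj => ?_
    rw [Pi.mulSingle_eq_of_ne (Finset.ne_of_mem_erase hj)]

theorem siteOp_add (i : ι) (u v : Matrix (Fin 2) (Fin 2) ℂ) :
    siteOp i (u + v) = siteOp i u + siteOp i v := by
  ext x y
  simp [siteOp_apply, add_mul]

theorem siteOp_smul (i : ι) (c : ℂ) (u : Matrix (Fin 2) (Fin 2) ℂ) :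
    siteOp i (c • u) = c • siteOp i u := by
  ext x y
  simp [siteOp_apply, mul_assoc]

theorem siteOp_one (i : ι) : siteOp i (1 : Matrix (Fin 2) (Fin 2) ℂ) = 1 := by
  rw [siteOp, Pi.mulSingle_one, tensorOp_one]

/-- `siteOp` as a linear map. -/
def siteLin (i : ι) : Matrix (Fin 2) (Fin 2) ℂ →ₗ[ℂ] Op ι where
  toFun := siteOp i
  map_add' := siteOp_add i
  map_smul' := siteOp_smul i

theorem star_siteOp (i : ι) (u : Matrix (Fin 2) (Fin 2) ℂ) :
    star (siteOp i u) = siteOp i (star u) := by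
  rw [siteOp, star_tensorOp, siteOp]
  congr 1
  funext j
  by_cases h : j = i
  · subst h
    simp
  · simp [h]

theorem tensorOp_eq_mul_siteOp (q : ι → Matrix (Fin 2) (Fin 2) ℂ) (i : ι) :
    tensorOp q = tensorOp (Function.update q i 1) * siteOp i (q i) := by
  rw [siteOp, tensorOp_mul]
  congr 1
  funext j
  by_cases h : j = i
  · subst h
    simp
  · simp [h]

/-- The algebra of operators that act only on the qubits in `s`: the operators that commute with
every one-qubit operator outside `s`. -/
def localAlg (s : Set ι) : StarSubalgebra ℂ (Op ι) :=
  StarSubalgebra.centralizer ℂ {g | ∃ i ∉ s, ∃ u, g = siteOp i u}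

theorem mem_localAlg_iff {s : Set ι} {X : Op ι} :
    X ∈ localAlg s ↔ ∀ i ∉ s, ∀ u, siteOp i u * X = X * siteOp i u := by
  rw [localAlg, StarSubalgebra.mem_centralizer_iff]
  constructor
  · exact fun h i hi u => (h _ ⟨i, hi, u, rfl⟩).1
  · rintro h _ ⟨i, hi, u, rfl⟩
    exact ⟨h i hi u, by rw [star_siteOp]; exact h i hi _⟩

theorem localAlg_mono {s t : Set ι} (h : s ⊆ t) : localAlg s ≤ localAlg t := fun _ hX =>
  mem_localAlg_iff.2 fun i hi u => mem_localAlg_iff.1 hX i (fun hs => hi (h hs)) u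

theorem tensorOp_mem_localAlg {s : Set ι} {q : ι → Matrix (Fin 2) (Fin 2) ℂ}
    (hq : ∀ i ∉ s, q i = 1) : tensorOp q ∈ localAlg s := by
  refine mem_localAlg_iff.2 fun i hi u => ?_
  rw [siteOp, tensorOp_mul, tensorOp_mul]
  congr 1
  funext j
  by_cases h : j = i
  · subst h
    simp [hq j hi]
  · simp [h]

theorem siteOp_mem_localAlg {s : Set ι} {i : ι} (hi : i ∈ s) (u : Matrix (Fin 2) (Fin 2) ℂ) :
    siteOp i u ∈ localAlg s :=
  tensorOp_mem_localAlg fun j hj => Pi.mulSingle_eq_of_ne (by rintro rfl; exact hj hi) _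

theorem tensorOp_mul_comm_of_mem_localAlg {s : Set ι} {q : ι → Matrix (Fin 2) (Fin 2) ℂ}
    (hq : ∀ i ∈ s, q i = 1) {X : Op ι} (hX : X ∈ localAlg s) :
    tensorOp q * X = X * tensorOp q := by
  -- Induction on a finite set carrying the nontrivial factors: one site operator is split off at a
  -- time, and it commutes with `X` by definition of `localAlg`.
  suffices H : ∀ (t : Finset ι) (q : ι → Matrix (Fin 2) (Fin 2) ℂ), (∀ i ∈ s, q i = 1) →
      (∀ i ∉ t, q i = 1) → tensorOp q * X = X * tensorOp q from
    H Finset.univ q hq fun i hi => absurd (Finset.mem_univ i) hi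
  intro t
  induction t using Finset.induction_on with
  | empty =>
    intro q _ h
    have : q = 1 := funext fun i => h i (Finset.notMem_empty i)
    rw [this, tensorOp_one, one_mul, mul_one]
  | insert i t _ ih =>
    intro q hs ht
    by_cases his : i ∈ s
    · refine ih q hs fun j hj => ?_
      by_cases hji : j = i
      · rw [hji]; exact hs i his
      · exact ht j (by simp [hji, hj])
    rw [tensorOp_eq_mul_siteOp q i, mul_assoc, mem_localAlg_iff.1 hX i his, ← mul_assoc,
      ih (Function.update q i 1) ?_ ?_, mul_assoc]
    · intro j hj
      rw [Function.update_of_ne (by rintro rfl; exact his hj), hs j hj]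
    · intro j hj
      by_cases hji : j = i
      · rw [hji, Function.update_self]
      · rw [Function.update_of_ne hji, ht j (by simp [hji, hj])]

/-- A linear functional on one-qubit operators that vanishes on commutators is a multiple of the
trace. -/
theorem eq_trace_of_tracial {φ : Matrix (Fin 2) (Fin 2) ℂ →ₗ[ℂ] ℂ}
    (h : ∀ u v, φ (u * v) = φ (v * u)) (u : Matrix (Fin 2) (Fin 2) ℂ) :
    φ u = u.trace / 2 * φ 1 := by
  have hne : ∀ a b : Fin 2, a ≠ b → φ (Matrix.single a b 1) = 0 := by
    intro a b hab
    have := h (Matrix.single a a 1) (Matrix.single a b 1)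
    rwa [Matrix.single_mul_single_same, Matrix.single_mul_single_of_ne (h := hab.symm), map_zero,
      one_mul] at this
  have heq : φ (Matrix.single 0 0 1) = φ (Matrix.single 1 1 1) := by
    have := h (Matrix.single 0 1 1) (Matrix.single 1 0 1)
    rwa [Matrix.single_mul_single_same, Matrix.single_mul_single_same, one_mul] at this
  have hexp : ∀ v : Matrix (Fin 2) (Fin 2) ℂ, φ v = v.trace * φ (Matrix.single 1 1 1) := by
    intro v
    conv_lhs => rw [Matrix.matrix_eq_sum_single v]
    have hs : ∀ a b : Fin 2, φ (Matrix.single a b (v a b)) = v a b * φ (Matrix.single a b 1) := by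
      intro a b
      rw [← smul_eq_mul, ← map_smul, Matrix.smul_single, smul_eq_mul, mul_one]
    simp only [Fin.sum_univ_two, map_add, hs, hne 0 1 (by decide), hne 1 0 (by decide), heq,
      Matrix.trace_fin_two]
    ring
  rw [hexp u, hexp 1, Matrix.trace_one]
  simp only [Fintype.card_fin]
  push_cast
  ring

/-- `X` and the remaining factors commute with the qubit `i`, so the trace is a tracial functional
of the operator at `i`, hence a multiple of its trace. -/
theorem trace_mul_tensorOp_update {s : Set ι} {X : Op ι} (hX : X ∈ localAlg s) {i : ι}
    (hi : i ∉ s) (q : ι → Matrix (Fin 2) (Fin 2) ℂ) :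
    (X * tensorOp q).trace = (q i).trace / 2 * (X * tensorOp (Function.update q i 1)).trace := by
  have hW : ∀ u, siteOp i u * (X * tensorOp (Function.update q i 1)) =
      X * tensorOp (Function.update q i 1) * siteOp i u := by
    have hs : s ⊆ ({i}ᶜ : Set ι) := by simpa using hi
    refine mem_localAlg_iff.1 (mul_mem (localAlg_mono hs hX)
      (tensorOp_mem_localAlg fun j hj => ?_)) i (by simp)
    have : j = i := by simpa using hj
    rw [this, Function.update_self]
  have h := eq_trace_of_tracial (φ := (Matrix.traceLinearMap (Config ι) ℂ ℂ).comp
    ((LinearMap.mulLeft ℂ (X * tensorOp (Function.update q i 1))).comp (siteLin i))) (by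
      intro u v
      simp only [LinearMap.comp_apply, LinearMap.mulLeft_apply, Matrix.traceLinearMap_apply]
      change (_ * siteOp i (u * v)).trace = (_ * siteOp i (v * u)).trace
      rw [← siteOp_mul, ← siteOp_mul, ← mul_assoc, ← hW, mul_assoc, Matrix.trace_mul_comm,
        mul_assoc]) (q i)
  simp only [LinearMap.comp_apply, LinearMap.mulLeft_apply, Matrix.traceLinearMap_apply] at h
  change (_ * siteOp i (q i)).trace = _ * (_ * siteOp i 1).trace at h
  rw [siteOp_one, mul_one, mul_assoc, ← tensorOp_eq_mul_siteOp] at h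
  exact h

open Classical in
theorem trace_mul_tensorOp {s : Set ι} {X : Op ι} (hX : X ∈ localAlg s)
    (q : ι → Matrix (Fin 2) (Fin 2) ℂ) :
    (X * tensorOp q).trace = (X * tensorOp fun i => if i ∈ s then q i else
      ((q i).trace / 2) • 1).trace := by
  suffices H : ∀ t : Finset ι, (X * tensorOp q).trace =
      (X * tensorOp fun i => if i ∈ s ∨ i ∉ t then q i else ((q i).trace / 2) • 1).trace by
    simpa using H Finset.univ
  intro t
  induction t using Finset.induction_on with
  | empty => simp
  | insert i t hit ih =>
    rw [ih]
    by_cases his : i ∈ s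
    · congr 3
      funext j
      by_cases hji : j = i
      · simp [hji, his]
      · simp [hji]
    · rw [trace_mul_tensorOp_update hX his]
      rw [trace_mul_tensorOp_update (q := fun j => if j ∈ s ∨ j ∉ insert i t then q j else _) hX his]
      congr 1
      · simp [his, hit, Matrix.trace_smul]
      · congr 3
        funext j
        by_cases hji : j = i
        · simp [hji]
        · simp [hji]

-- Identifies the abstract projection with the partial trace: each factor outside `s` becomes its
-- normalized trace times the identity.
open Classical in
theorem condExp_tensorOp (s : Set ι) (q : ι → Matrix (Fin 2) (Fin 2) ℂ) :
    condExp (localAlg s) (tensorOp q) =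
      tensorOp fun i => if i ∈ s then q i else ((q i).trace / 2) • 1 := by
  refine condExp_eq_of_inner ?_ fun W hW => ?_
  · have : (tensorOp fun i => if i ∈ s then q i else ((q i).trace / 2) • 1) =
        (∏ i, if i ∈ s then 1 else (q i).trace / 2) • tensorOp fun i => if i ∈ s then q i else 1 := by
      rw [← tensorOp_smul]
      congr 1
      funext i
      split_ifs <;> simp
    rw [this]
    exact (localAlg s).smul_mem (tensorOp_mem_localAlg fun i hi => if_neg hi) _
  · rw [inner_eq_trace, inner_eq_trace, trace_mul_tensorOp (star_mem hW) q]

theorem trace_mul_of_mem_localAlg_empty {X : Op ι} (hX : X ∈ localAlg (∅ : Set ι)) (Y : Op ι) :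
    (X * Y).trace = X.trace * Y.trace / 2 ^ Fintype.card ι := by
  have hsingle : ∀ x y : Config ι, (X * Matrix.single x y 1).trace =
      X.trace * (Matrix.single x y (1 : ℂ)).trace / 2 ^ Fintype.card ι := by
    intro x y
    rw [single_eq_tensorOp, trace_mul_tensorOp hX, trace_tensorOp]
    simp only [Set.mem_empty_iff_false, if_false]
    rw [tensorOp_smul]
    change (X * (_ • tensorOp 1)).trace = _
    rw [tensorOp_one, Matrix.mul_smul, mul_one, Matrix.trace_smul, Finset.prod_div_distrib]
    simp only [Finset.prod_const, Finset.card_univ, smul_eq_mul]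
    ring
  rw [Matrix.matrix_eq_sum_single Y]
  simp only [Finset.mul_sum, Matrix.trace_sum, Finset.sum_div]
  refine Finset.sum_congr rfl fun x _ => Finset.sum_congr rfl fun y _ => ?_
  have : Matrix.single x y (Y x y) = Y x y • Matrix.single x y 1 := by
    rw [Matrix.smul_single, smul_eq_mul, mul_one]
  rw [this, Matrix.mul_smul, Matrix.trace_smul, Matrix.trace_smul, hsingle]
  simp only [smul_eq_mul]
  ring

/-- For a site in `s` but not in `t`, its operators belong to `localAlg s`, so they pass through the
projection and inherit commutation from `Y`. -/
theorem condExp_mem_inter {s t : Set ι} {Y : Op ι} (hY : Y ∈ localAlg t) :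
    condExp (localAlg s) Y ∈ localAlg (s ∩ t) := by
  refine mem_localAlg_iff.2 fun i hi u => ?_
  by_cases his : i ∈ s
  · have hit : i ∉ t := fun h => hi ⟨his, h⟩
    have hu := siteOp_mem_localAlg his u
    rw [← condExp_mul_left hu, ← condExp_mul_right hu, mem_localAlg_iff.1 hY i hit]
  · exact mem_localAlg_iff.1 (condExp_mem Y) i his u

/-- Operators on complementary sets of qubits are independent with respect to the normalized
trace. -/
theorem trace_mul_of_mem_compl {s : Set ι} {X Y : Op ι} (hX : X ∈ localAlg s)
    (hY : Y ∈ localAlg sᶜ) : (X * Y).trace = X.trace * Y.trace / 2 ^ Fintype.card ι := by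
  have h0 : condExp (localAlg s) Y ∈ localAlg (∅ : Set ι) := by
    have := condExp_mem_inter (s := s) hY
    rwa [Set.inter_compl_self] at this
  have h1 := inner_condExp (star_mem hX) Y
  have h2 := inner_condExp (one_mem (localAlg s)) Y
  simp only [inner_eq_trace, star_star, star_one, one_mul] at h1 h2
  rw [← h1, Matrix.trace_mul_comm, trace_mul_of_mem_localAlg_empty h0, h2, mul_comm Y.trace]

end Tensor

/-! ### Embedded operators, norm bounds and partial traces. -/

section Embed

variable {κ ι : Type*} {f : κ → ι}

theorem embedOp_apply_of_eq (f : κ → ι) (M : Op κ) {x y : Config ι}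
    (h : ∀ j, j ∉ Set.range f → x j = y j) : embedOp f M x y = M (x ∘ f) (y ∘ f) := by
  rw [embedOp, Matrix.of_apply, if_pos h]

theorem embedOp_apply_of_ne (f : κ → ι) (M : Op κ) {x y : Config ι}
    (h : ¬ ∀ j, j ∉ Set.range f → x j = y j) : embedOp f M x y = 0 := by
  rw [embedOp, Matrix.of_apply, if_neg h]

theorem embedOp_add (f : κ → ι) (M N : Op κ) : embedOp f (M + N) = embedOp f M + embedOp f N := by
  ext x y
  by_cases h : ∀ j, j ∉ Set.range f → x j = y j
  · simp [embedOp_apply_of_eq f _ h]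
  · simp [embedOp_apply_of_ne f _ h]

theorem embedOp_smul (f : κ → ι) (c : ℂ) (M : Op κ) : embedOp f (c • M) = c • embedOp f M := by
  ext x y
  by_cases h : ∀ j, j ∉ Set.range f → x j = y j
  · simp [embedOp_apply_of_eq f _ h]
  · simp [embedOp_apply_of_ne f _ h]

/-- `embedOp` as a linear map. -/
def embedLin (f : κ → ι) : Op κ →ₗ[ℂ] Op ι where
  toFun := embedOp f
  map_add' := embedOp_add f
  map_smul' := embedOp_smul f

theorem star_embedOp (f : κ → ι) (M : Op κ) : star (embedOp f M) = embedOp f (star M) := by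
  ext x y
  rw [Matrix.star_apply]
  by_cases h : ∀ j, j ∉ Set.range f → x j = y j
  · rw [embedOp_apply_of_eq f _ h, embedOp_apply_of_eq f _ fun j hj => (h j hj).symm]
    rfl
  · rw [embedOp_apply_of_ne f _ h, embedOp_apply_of_ne f _ fun h' => h fun j hj => (h' j hj).symm,
      star_zero]

/-- Hides the conditional in `partialTrace` behind the properties of its summand needed for the
trace duality. -/
theorem exists_partialTrace_eq_sum [Fintype ι] [DecidableEq ι] (f : κ → ι) (ρ : Op ι) :
    ∃ G : Config κ → Config κ → Config ι → Config ι → ℂ,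
      (∀ a b, partialTrace f ρ a b = ∑ x, ∑ y, G a b x y) ∧
      (∀ x y, (∀ j, j ∉ Set.range f → x j = y j) → G (x ∘ f) (y ∘ f) x y = ρ x y) ∧
      ∀ a b x y, ¬ (x ∘ f = a ∧ y ∘ f = b ∧ ∀ j, j ∉ Set.range f → x j = y j) →
        G a b x y = 0 :=
  ⟨_, fun _ _ => rfl, fun _ _ h => if_pos ⟨rfl, rfl, h⟩, fun _ _ _ _ h => if_neg h⟩

variable [Fintype κ] [Fintype ι]

theorem embedOp_tensorOp (hf : Function.Injective f) (p : κ → Matrix (Fin 2) (Fin 2) ℂ) :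
    embedOp f (tensorOp p) = tensorOp (Function.extend f p 1) := by
  ext x y
  by_cases h : ∀ j, j ∉ Set.range f → x j = y j
  · rw [embedOp_apply_of_eq f _ h, tensorOp_apply, tensorOp_apply]
    refine Fintype.prod_of_injective f hf _ _ (fun j hj => ?_) fun k => ?_
    · rw [Function.extend_apply' _ _ _ (by simpa using hj), h j hj]
      simp
    · rw [hf.extend_apply]
      rfl
  · rw [embedOp_apply_of_ne f _ h, tensorOp_apply]
    push Not at h
    obtain ⟨j, hj, hne⟩ := h
    refine (Finset.prod_eq_zero (Finset.mem_univ j) ?_).symm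
    rw [Function.extend_apply' _ _ _ (by simpa using hj)]
    simp [Matrix.one_apply_ne hne]

theorem embedOp_eq_sum [DecidableEq κ] (hf : Function.Injective f) (M : Op κ) :
    embedOp f M = ∑ a, ∑ b, M a b •
      tensorOp (Function.extend f (fun k => Matrix.single (a k) (b k) 1) 1) := by
  classical
  have h := congrArg (embedLin f) (Matrix.matrix_eq_sum_single M)
  simp only [map_sum] at h
  refine h.trans (Finset.sum_congr rfl fun a _ => Finset.sum_congr rfl fun b _ => ?_)
  have hs : Matrix.single a b (M a b) = M a b • Matrix.single a b 1 := by
    rw [Matrix.smul_single, smul_eq_mul, mul_one]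
  rw [hs, map_smul, single_eq_tensorOp, ← embedOp_tensorOp hf]
  rfl

variable [DecidableEq ι]

theorem embedOp_mem_localAlg [DecidableEq κ] (hf : Function.Injective f) {s : Set ι} (hs : Set.range f ⊆ s)
    (M : Op κ) : embedOp f M ∈ localAlg s := by
  rw [embedOp_eq_sum hf]
  refine sum_mem fun a _ => sum_mem fun b _ => (localAlg s).smul_mem
    (tensorOp_mem_localAlg fun i hi => ?_) _
  rw [Function.extend_apply' _ _ _ fun ⟨k, hk⟩ => hi (hs ⟨k, hk⟩)]
  rfl

theorem embedOp_mul_comm [DecidableEq κ] (hf : Function.Injective f) {s : Set ι} (hs : Disjoint (Set.range f) s)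
    (M : Op κ) {W : Op ι} (hW : W ∈ localAlg s) : embedOp f M * W = W * embedOp f M := by
  rw [embedOp_eq_sum hf]
  simp only [Finset.sum_mul, Finset.mul_sum]
  refine Finset.sum_congr rfl fun a _ => Finset.sum_congr rfl fun b _ => ?_
  rw [Matrix.smul_mul, Matrix.mul_smul, tensorOp_mul_comm_of_mem_localAlg (fun i hi => ?_) hW]
  rw [Function.extend_apply' _ _ _ fun ⟨k, hk⟩ => Set.disjoint_left.1 hs ⟨k, hk⟩ hi]
  rfl

open Classical in
theorem sum_ite_agree [DecidableEq κ] {E : Type*} [AddCommMonoid E] (hf : Function.Injective f)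
    (x : Config ι) (F : Config ι → E) :
    (∑ y, if ∀ j, j ∉ Set.range f → x j = y j then F y else 0) =
      ∑ b : Config κ, F (Function.extend f b x) := by
  rw [← Finset.sum_filter]
  symm
  refine Finset.sum_bij' (fun b _ => Function.extend f b x) (fun y _ => y ∘ f) ?_ ?_ ?_ ?_ ?_
  · intro b _
    refine Finset.mem_filter.2 ⟨Finset.mem_univ _, fun j hj => ?_⟩
    rw [Function.extend_apply' _ _ _ (by simpa using hj)]
  · intro y _
    exact Finset.mem_univ _
  · intro b _
    exact Function.extend_comp hf b x
  · intro y hy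
    funext j
    by_cases hj : j ∈ Set.range f
    · obtain ⟨k, rfl⟩ := hj
      rw [hf.extend_apply]
      rfl
    · rw [Function.extend_apply' _ _ _ (by simpa using hj)]
      exact (Finset.mem_filter.1 hy).2 j hj
  · intro b _
    rfl

-- Agreement off the range of `f` is symmetric, and each of its classes has as many elements as
-- `Config κ`; this is double counting.
open Classical in
theorem sum_sum_extend [DecidableEq κ] (hf : Function.Injective f) (F : Config ι → ℝ) :
    ∑ x, ∑ b : Config κ, F (Function.extend f b x) = Fintype.card (Config κ) * ∑ x, F x := by
  simp only [← sum_ite_agree hf]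
  rw [Finset.sum_comm, Finset.mul_sum]
  refine Finset.sum_congr rfl fun y _ => ?_
  have h := sum_ite_agree hf y fun _ => F y
  rw [Finset.sum_const, Finset.card_univ, nsmul_eq_mul] at h
  rw [← h]
  refine Finset.sum_congr rfl fun x _ => if_congr ?_ rfl rfl
  exact forall₂_congr fun j _ => eq_comm

theorem embedOp_mul_apply [DecidableEq κ] {n : Type*} (hf : Function.Injective f) (M : Op κ)
    (X : Matrix (Config ι) n ℂ) (x : Config ι) (z : n) :
    (embedOp f M * X) x z = ∑ b : Config κ, M (x ∘ f) b * X (Function.extend f b x) z := by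
  classical
  rw [Matrix.mul_apply]
  have h := sum_ite_agree hf x fun y => M (x ∘ f) (y ∘ f) * X y z
  simp only [Function.extend_comp hf] at h
  rw [← h]
  refine Finset.sum_congr rfl fun y _ => ?_
  split_ifs with hxy
  · rw [embedOp_apply_of_eq f _ hxy]
  · rw [embedOp_apply_of_ne f _ hxy, zero_mul]

/-- Tensoring with the identity does not increase the operator norm, so that the Hilbert-Schmidt
norm of `M` bounds the operator norm of `M ⊗ 1`. -/
theorem norm_embedOp_mul_le [DecidableEq κ] (hf : Function.Injective f) (M : Op κ) (X : Op ι) :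
    ‖embedOp f M * X‖ ≤ ‖M‖ * ‖X‖ := by
  refine le_of_sq_le_sq ?_ (by positivity)
  rw [mul_pow, norm_sq_eq_sum, norm_sq_eq_sum, norm_sq_eq_sum X, Finset.sum_comm,
    Finset.sum_comm (f := fun i j => ‖X i j‖ ^ 2), Finset.mul_sum]
  refine Finset.sum_le_sum fun z _ => ?_
  set N : Config κ → ℝ := fun a => ∑ b, ‖M a b‖ ^ 2 with hN
  set V : Config ι → ℝ := fun x => ∑ b : Config κ, ‖X (Function.extend f b x) z‖ ^ 2 with hV
  have h1 : ∀ x, ‖(embedOp f M * X) x z‖ ^ 2 ≤ N (x ∘ f) * V x := by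
    intro x
    rw [embedOp_mul_apply hf]
    calc _ ≤ (∑ b, ‖M (x ∘ f) b‖ * ‖X (Function.extend f b x) z‖) ^ 2 := by
          gcongr
          exact (norm_sum_le _ _).trans (Finset.sum_le_sum fun b _ => norm_mul_le _ _)
      _ ≤ _ := Finset.sum_mul_sq_le_sq_mul_sq _ _ _
  have hc : (0 : ℝ) < Fintype.card (Config κ) := by exact_mod_cast Fintype.card_pos
  have hext : ∀ (x : Config ι) (a b : Config κ),
      Function.extend f b (Function.extend f a x) = Function.extend f b x := by
    intro x a b
    funext j
    by_cases hj : ∃ k, f k = j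
    · obtain ⟨k, rfl⟩ := hj
      rw [hf.extend_apply, hf.extend_apply]
    · rw [Function.extend_apply' _ _ _ hj, Function.extend_apply' _ _ _ hj,
        Function.extend_apply' _ _ _ hj]
  -- `V` is constant on each class of configurations agreeing off the range of `f`, while `x ∘ f`
  -- runs through every value there; averaging over classes factors the sum.
  have h2 : Fintype.card (Config κ) * ∑ x, N (x ∘ f) * V x =
      Fintype.card (Config κ) * ((∑ a, N a) * ∑ x, ‖X x z‖ ^ 2) := by
    rw [← sum_sum_extend hf]
    simp only [hV, hext, Function.extend_comp hf]
    simp only [← Finset.sum_mul]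
    rw [← Finset.mul_sum, sum_sum_extend hf fun x => ‖X x z‖ ^ 2]
    ring
  calc _ ≤ ∑ x, N (x ∘ f) * V x := Finset.sum_le_sum fun x _ => h1 x
    _ = _ := mul_left_cancel₀ hc.ne' h2

theorem norm_mul_embedOp_le [DecidableEq κ] (hf : Function.Injective f) (M : Op κ) (X : Op ι) :
    ‖X * embedOp f M‖ ≤ ‖M‖ * ‖X‖ := by
  have h := norm_embedOp_mul_le hf (star M) (star X)
  have h' : embedOp f (star M) * star X = star (X * embedOp f M) := by
    rw [← star_embedOp, ← star_mul]
  rw [h', frobenius_norm_star, frobenius_norm_star, frobenius_norm_star] at h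
  exact h

theorem trace_embedOp_mul [DecidableEq κ] (f : κ → ι) (M : Op κ) (ρ : Op ι) :
    (embedOp f M * ρ).trace = (M * partialTrace f ρ).trace := by
  obtain ⟨G, hG, hG1, hG0⟩ := exists_partialTrace_eq_sum f ρ
  have h : ∀ x y : Config ι, embedOp f M x y * ρ y x = ∑ a, ∑ b, M a b * G b a y x := by
    intro x y
    rw [Finset.sum_eq_single (x ∘ f), Finset.sum_eq_single (y ∘ f)]
    · by_cases hxy : ∀ j, j ∉ Set.range f → x j = y j
      · rw [embedOp_apply_of_eq f _ hxy, hG1 y x fun j hj => (hxy j hj).symm]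
      · rw [embedOp_apply_of_ne f _ hxy, hG0, zero_mul, mul_zero]
        exact fun h => hxy fun j hj => (h.2.2 j hj).symm
    · intro b _ hb
      rw [hG0 _ _ _ _ fun h => hb h.1.symm, mul_zero]
    · exact fun h => absurd (Finset.mem_univ _) h
    · intro a _ ha
      exact Finset.sum_eq_zero fun b _ => by rw [hG0 _ _ _ _ fun h => ha h.2.1.symm, mul_zero]
    · exact fun h => absurd (Finset.mem_univ _) h
  simp only [Matrix.trace, Matrix.diag_apply, Matrix.mul_apply, hG, h, Finset.mul_sum]
  rw [Finset.sum_comm]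
  calc _ = ∑ y, ∑ a, ∑ x, ∑ b, M a b * G b a y x :=
        Finset.sum_congr rfl fun y _ => Finset.sum_comm
    _ = ∑ a, ∑ y, ∑ b, ∑ x, M a b * G b a y x := by
        rw [Finset.sum_comm]
        exact Finset.sum_congr rfl fun a _ => Finset.sum_congr rfl fun y _ => Finset.sum_comm
    _ = _ := Finset.sum_congr rfl fun a _ => Finset.sum_comm

theorem siteOp_eq_embedOp (i : ι) (u : Matrix (Fin 2) (Fin 2) ℂ) :
    siteOp i u = embedOp (fun _ : Fin 1 => i) (tensorOp fun _ => u) := by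
  have hf : Function.Injective (fun _ : Fin 1 => i) := Function.injective_of_subsingleton _
  rw [embedOp_tensorOp hf, siteOp]
  congr 1
  funext j
  by_cases h : j = i
  · subst h
    rw [Pi.mulSingle_eq_same]
    exact (hf.extend_apply (fun _ => u) 1 (0 : Fin 1)).symm
  · rw [Pi.mulSingle_eq_of_ne h, Function.extend_apply' _ _ _ fun ⟨_, hk⟩ => h hk.symm]
    rfl

theorem norm_siteOp_mul_le (i : ι) (u : Matrix (Fin 2) (Fin 2) ℂ) (X : Op ι) :
    ‖siteOp i u * X‖ ≤ ‖u‖ * ‖X‖ := by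
  have h := norm_embedOp_mul_le (Function.injective_of_subsingleton (fun _ : Fin 1 => i))
    (tensorOp fun _ => u) X
  rw [← siteOp_eq_embedOp] at h
  have hu : ‖(tensorOp fun _ : Fin 1 => u)‖ = ‖u‖ := by
    rw [← sq_eq_sq₀ (norm_nonneg _) (norm_nonneg _), norm_sq_eq_sum, norm_sq_eq_sum]
    refine Fintype.sum_equiv (Equiv.funUnique (Fin 1) (Fin 2)) _ _ fun a =>
      Fintype.sum_equiv (Equiv.funUnique (Fin 1) (Fin 2)) _ _ fun b => ?_
    simp [tensorOp_apply]
  rwa [hu] at h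

end Embed

/-! ### The correlation operator and its commutators with local terms. -/

section Correlation

variable {ι : Type*} [Fintype ι] [DecidableEq ι]

/-- The correlation operator of `ρ` with respect to the bipartition `A`, `Aᶜ`: the difference of
`ρ` and the product of its two marginals. -/
def corr (A : Set ι) (ρ : Op ι) : Op ι :=
  ρ - (2 ^ Fintype.card ι : ℂ) • (condExp (localAlg A) ρ * condExp (localAlg Aᶜ) ρ)

/-- The derivative of `corr A` at `ρ` in the direction `σ`. -/
def corrDeriv (A : Set ι) (ρ σ : Op ι) : Op ι :=
  σ - (2 ^ Fintype.card ι : ℂ) • (condExp (localAlg A) σ * condExp (localAlg Aᶜ) ρ +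
    condExp (localAlg A) ρ * condExp (localAlg Aᶜ) σ)

theorem corrDeriv_add (A : Set ι) (ρ σ τ : Op ι) :
    corrDeriv A ρ (σ + τ) = corrDeriv A ρ σ + corrDeriv A ρ τ := by
  simp only [corrDeriv, map_add, add_mul, mul_add, smul_add]
  abel

theorem corrDeriv_smul (A : Set ι) (ρ : Op ι) (c : ℂ) (σ : Op ι) :
    corrDeriv A ρ (c • σ) = c • corrDeriv A ρ σ := by
  simp only [corrDeriv, map_smul, Matrix.smul_mul, Matrix.mul_smul, smul_sub, smul_add]
  rw [smul_comm c, smul_comm c]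

/-- At every site one projection keeps `p i` and the other leaves half the identity, so the product
is ρ divided by 2 once per qubit, which the prefactor undoes. -/
theorem corr_tensorOp (A : Set ι) {p : ι → Matrix (Fin 2) (Fin 2) ℂ}
    (hp : ∀ i, (p i).trace = 1) : corr A (tensorOp p) = 0 := by
  classical
  rw [corr, condExp_tensorOp, condExp_tensorOp, tensorOp_mul]
  have h : tensorOp p - (2 ^ Fintype.card ι : ℂ) • tensorOp (fun i => (1 / 2 : ℂ) • p i) = 0 := by
    rw [tensorOp_smul, smul_smul]
    simp
  convert h using 4
  funext i
  by_cases hi : i ∈ A <;> simp [hi, hp]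

theorem norm_corr_le (A : Set ι) (ρ : Op ι) :
    ‖corr A ρ‖ ≤ ‖ρ‖ + 2 ^ Fintype.card ι * (‖ρ‖ * ‖ρ‖) := by
  refine (norm_sub_le _ _).trans ?_
  rw [norm_smul, norm_pow, Complex.norm_ofNat]
  gcongr
  refine (norm_mul_le _ _).trans ?_
  gcongr
  · exact norm_condExp_le ρ
  · exact norm_condExp_le ρ

section Commutator

variable {κ : Type*} [Fintype κ] [DecidableEq κ] {f : κ → ι}

theorem star_embedOp_mul_comm (hf : Function.Injective f) {s : Set ι}
    (hs : Disjoint (Set.range f) s) (M : Op κ) {W : Op ι} (hW : W ∈ localAlg s) :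
    star (embedOp f M) * W = W * star (embedOp f M) := by
  rw [star_embedOp]
  exact embedOp_mul_comm hf hs _ hW

/-- The marginal on `A` evolves by the same commutator; the marginal on the complement neither moves
nor fails to commute with the term. -/
theorem corrDeriv_commutator_of_subset (hf : Function.Injective f) {A : Set ι}
    (hA : Set.range f ⊆ A) (M : Op κ) (ρ : Op ι) :
    corrDeriv A ρ (embedOp f M * ρ - ρ * embedOp f M) =
      embedOp f M * corr A ρ - corr A ρ * embedOp f M := by
  have hd : Disjoint (Set.range f) Aᶜ := Set.disjoint_compl_right_iff_subset.2 hA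
  have h1 := condExp_commutator_of_mem (embedOp_mem_localAlg hf hA M) ρ
  have h2 := condExp_commutator_of_commute (S := localAlg Aᶜ)
    (fun W hW => star_embedOp_mul_comm hf hd M hW) ρ
  have h3 := embedOp_mul_comm hf hd M (condExp_mem (S := localAlg Aᶜ) ρ)
  rw [corrDeriv, corr, h1, h2, mul_zero, add_zero, sub_mul, mul_assoc (condExp (localAlg A) ρ), h3]
  simp only [mul_sub, sub_mul, Matrix.mul_smul, Matrix.smul_mul, smul_sub, mul_assoc]
  abel

theorem corrDeriv_commutator_of_subset_compl (hf : Function.Injective f) {A : Set ι}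
    (hA : Set.range f ⊆ Aᶜ) (M : Op κ) (ρ : Op ι) :
    corrDeriv A ρ (embedOp f M * ρ - ρ * embedOp f M) =
      embedOp f M * corr A ρ - corr A ρ * embedOp f M := by
  have hd : Disjoint (Set.range f) A := Set.subset_compl_iff_disjoint_right.1 hA
  have h1 := condExp_commutator_of_mem (embedOp_mem_localAlg hf hA M) ρ
  have h2 := condExp_commutator_of_commute (S := localAlg A)
    (fun W hW => star_embedOp_mul_comm hf hd M hW) ρ
  have h3 := embedOp_mul_comm hf hd M (condExp_mem (S := localAlg A) ρ)
  rw [corrDeriv, corr, h1, h2, zero_mul, zero_add, mul_sub, ← mul_assoc (condExp (localAlg A) ρ),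
    ← h3]
  simp only [mul_sub, sub_mul, Matrix.mul_smul, Matrix.smul_mul, smul_sub, mul_assoc]
  abel

theorem inner_commutator_of_disjoint (hf : Function.Injective f) {s : Set ι}
    (hs : Disjoint (Set.range f) s) (M : Op κ) {W : Op ι} (hW : W ∈ localAlg s) (X : Op ι) :
    inner ℂ W (embedOp f M * X - X * embedOp f M) = 0 := by
  rw [inner_sub_right, inner_mul_comm_of_commute (star_embedOp_mul_comm hf hs M hW), sub_self]

/-- The range of `f` may meet both `A` and its complement, which covers the link across the cut. In
each product term the unmoved marginal is transferred to the side of `W`. -/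
theorem inner_corrDeriv_commutator_of_disjoint (hf : Function.Injective f) {A s : Set ι}
    (hs : Disjoint (Set.range f) s) (M : Op κ) {W : Op ι} (hW : W ∈ localAlg s) (ρ : Op ι) :
    inner ℂ W (corrDeriv A ρ (embedOp f M * ρ - ρ * embedOp f M)) = 0 := by
  -- After the transfer, the test operator lives on `s ∪ Bᶜ`; projecting onto `B` brings it back
  -- inside `s`, away from the range of `f`.
  have key : ∀ (B : Set ι) (V : Op ι), V ∈ localAlg (s ∪ Bᶜ) →
      inner ℂ V (condExp (localAlg B) (embedOp f M * ρ - ρ * embedOp f M)) = 0 := by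
    intro B V hV
    have h1 : condExp (localAlg B) V ∈ localAlg s := by
      refine localAlg_mono ?_ (condExp_mem_inter hV)
      rintro i ⟨hiB, his | hiB'⟩
      · exact his
      · exact absurd hiB hiB'
    rw [← inner_condExp_left]
    exact inner_commutator_of_disjoint hf hs M h1 ρ
  rw [corrDeriv, inner_sub_right, inner_smul_right, inner_add_right,
    inner_commutator_of_disjoint hf hs M hW]
  have h1 := inner_mul_right_eq (star (condExp (localAlg Aᶜ) ρ)) W
    (condExp (localAlg A) (embedOp f M * ρ - ρ * embedOp f M))
  have h2 := inner_mul_left_eq (star (condExp (localAlg A) ρ)) W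
    (condExp (localAlg Aᶜ) (embedOp f M * ρ - ρ * embedOp f M))
  rw [star_star] at h1 h2
  rw [← h1, ← h2, key, key, add_zero, mul_zero, sub_zero]
  · rw [compl_compl]
    exact mul_mem (star_mem (localAlg_mono Set.subset_union_right (condExp_mem ρ)))
      (localAlg_mono Set.subset_union_left hW)
  · exact mul_mem (localAlg_mono Set.subset_union_left hW)
      (star_mem (localAlg_mono Set.subset_union_right (condExp_mem ρ)))

/-- With D = E_s(G), the commutator moves onto D and stays in `localAlg s`, so G may be replaced by
D; a symmetric map has a real expectation in D. -/
theorem im_inner_condExp_commutator_of_subset (hf : Function.Injective f) {s : Set ι}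
    (hs : Set.range f ⊆ s) {M : Op κ} (hM : M.IsHermitian) (G : Op ι) :
    (inner ℂ (condExp (localAlg s) G) (embedOp f M * G - G * embedOp f M)).im = 0 := by
  have ha : star (embedOp f M) = embedOp f M := by
    rw [star_embedOp]
    exact congrArg _ hM
  have hm := embedOp_mem_localAlg hf hs M
  have hD := condExp_mem (S := localAlg s) G
  rw [← inner_commutator ha, ← inner_condExp (sub_mem (mul_mem hm hD) (mul_mem hD hm)),
    inner_commutator ha]
  exact inner_commutator_self_im ha _

/-- Moved onto E_s(G), the commutator lies in `localAlg t`, so only E_t(G) is seen; the factor 2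
counts the two terms of the commutator. -/
theorem norm_inner_condExp_commutator_le (hf : Function.Injective f) {s t : Set ι}
    (hst : s ⊆ t) (ht : Set.range f ⊆ t) {M : Op κ} (hM : M.IsHermitian) (G : Op ι) :
    ‖inner ℂ (condExp (localAlg s) G) (embedOp f M * G - G * embedOp f M)‖ ≤
      2 * ‖M‖ * (‖condExp (localAlg s) G‖ * ‖condExp (localAlg t) G‖) := by
  have ha : star (embedOp f M) = embedOp f M := by
    rw [star_embedOp]
    exact congrArg _ hM
  have hm := embedOp_mem_localAlg hf ht M
  have hD := localAlg_mono hst (condExp_mem (S := localAlg s) G)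
  rw [← inner_commutator ha, ← inner_condExp (sub_mem (mul_mem hm hD) (mul_mem hD hm))]
  refine (norm_inner_le_norm _ _).trans ?_
  rw [← mul_assoc]
  gcongr
  refine (norm_sub_le _ _).trans ?_
  have h1 := norm_embedOp_mul_le hf M (condExp (localAlg s) G)
  have h2 := norm_mul_embedOp_le hf M (condExp (localAlg s) G)
  linarith

end Commutator

end Correlation

/-! ### Absolute continuity and integration of differential inequalities. -/

section Analysis

theorem AbsolutelyContinuousOnInterval.comp_of_lipschitzOnWith {X Y : Type*}
    [PseudoMetricSpace X] [PseudoMetricSpace Y] {f : ℝ → X} {g : X → Y} {a b : ℝ} {C : NNReal}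
    {s : Set X} (hg : LipschitzOnWith C g s) (hs : ∀ t ∈ Set.uIcc a b, f t ∈ s)
    (hf : AbsolutelyContinuousOnInterval f a b) :
    AbsolutelyContinuousOnInterval (fun t => g (f t)) a b := by
  rw [absolutelyContinuousOnInterval_iff] at hf ⊢
  intro ε hε
  obtain ⟨δ, hδ, h⟩ := hf (ε / (C + 1)) (by positivity)
  refine ⟨δ, hδ, fun E hE hd => ?_⟩
  have hmem := hE.1
  calc ∑ i ∈ Finset.range E.1, dist (g (f (E.2 i).1)) (g (f (E.2 i).2))
      ≤ ∑ i ∈ Finset.range E.1, C * dist (f (E.2 i).1) (f (E.2 i).2) :=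
        Finset.sum_le_sum fun i hi => hg.dist_le_mul _ (hs _ (hmem i hi).1) _ (hs _ (hmem i hi).2)
    _ = C * ∑ i ∈ Finset.range E.1, dist (f (E.2 i).1) (f (E.2 i).2) := by rw [Finset.mul_sum]
    _ ≤ C * (ε / (C + 1)) := by gcongr; exact (h E hE hd).le
    _ < ε := by
        rw [mul_div_assoc', div_lt_iff₀ (by positivity)]
        nlinarith [C.coe_nonneg]

theorem AbsolutelyContinuousOnInterval.congr {X : Type*} [PseudoMetricSpace X] {f g : ℝ → X}
    {a b : ℝ} (hf : AbsolutelyContinuousOnInterval f a b) (h : ∀ t ∈ Set.uIcc a b, f t = g t) :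
    AbsolutelyContinuousOnInterval g a b := by
  rw [absolutelyContinuousOnInterval_iff] at hf ⊢
  intro ε hε
  obtain ⟨δ, hδ, H⟩ := hf ε hε
  refine ⟨δ, hδ, fun E hE hd => ?_⟩
  have hmem := hE.1
  refine lt_of_eq_of_lt (Finset.sum_congr rfl fun i hi => ?_) (H E hE hd)
  rw [h _ (hmem i hi).1, h _ (hmem i hi).2]

theorem AbsolutelyContinuousOnInterval.const {X : Type*} [PseudoMetricSpace X] (c : X) (a b : ℝ) :
    AbsolutelyContinuousOnInterval (fun _ => c) a b :=
  (LipschitzWith.const c).lipschitzOnWith.absolutelyContinuousOnInterval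

theorem AbsolutelyContinuousOnInterval.sum {ι F : Type*} [SeminormedAddCommGroup F]
    {f : ι → ℝ → F} {a b : ℝ} (s : Finset ι)
    (h : ∀ i, AbsolutelyContinuousOnInterval (f i) a b) :
    AbsolutelyContinuousOnInterval (fun t => ∑ i ∈ s, f i t) a b := by
  classical
  induction s using Finset.induction_on with
  | empty => simpa using AbsolutelyContinuousOnInterval.const (0 : F) a b
  | insert i s hi ih =>
    simp only [Finset.sum_insert hi]
    exact AbsolutelyContinuousOnInterval.fun_add (h i) ih

theorem AbsolutelyContinuousOnInterval.pi {ι F : Type*} [Fintype ι] [SeminormedAddCommGroup F]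
    {f : ℝ → ι → F} {a b : ℝ} (h : ∀ i, AbsolutelyContinuousOnInterval (fun t => f t i) a b) :
    AbsolutelyContinuousOnInterval f a b := by
  classical
  have hs := AbsolutelyContinuousOnInterval.sum Finset.univ fun i =>
    AbsolutelyContinuousOnInterval.comp_of_lipschitzOnWith
      (g := fun y : F => (Pi.single i y : ι → F)) (s := Set.univ) (C := 1)
      (LipschitzWith.of_dist_le_mul fun x y => by
        rw [NNReal.coe_one, one_mul]
        refine (dist_pi_le_iff dist_nonneg).2 fun j => ?_
        by_cases hj : j = i
        · subst hj
          simp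
        · simp [hj]).lipschitzOnWith (fun _ _ => Set.mem_univ _) (h i)
  refine AbsolutelyContinuousOnInterval.congr hs fun t _ => ?_
  exact Finset.univ_sum_single (f t)

/-- The path stays in a closed ball, which is compact and convex, so the map is Lipschitz there. -/
theorem AbsolutelyContinuousOnInterval.contDiff_comp {E F : Type*} [NormedAddCommGroup E]
    [NormedSpace ℝ E] [FiniteDimensional ℝ E] [NormedAddCommGroup F] [NormedSpace ℝ F]
    {f : ℝ → E} {g : E → F} {a b : ℝ} (hg : ContDiff ℝ 1 g)
    (hf : AbsolutelyContinuousOnInterval f a b) :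
    AbsolutelyContinuousOnInterval (fun t => g (f t)) a b := by
  obtain ⟨R, hR⟩ := hf.exists_bound
  obtain ⟨C, hC⟩ := (hg.contDiffOn (s := Metric.closedBall 0 R)).exists_lipschitzOnWith
    one_ne_zero (convex_closedBall _ _) (isCompact_closedBall _ _)
  exact AbsolutelyContinuousOnInterval.comp_of_lipschitzOnWith hC
    (fun t ht => mem_closedBall_zero_iff.2 (hR t ht)) hf

theorem absolutelyContinuousOnInterval_integral_complex {f : ℝ → ℂ} {a b : ℝ}
    (h : IntervalIntegrable f volume a b) :
    AbsolutelyContinuousOnInterval (fun t => ∫ s in a..t, f s) a b := by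
  have hre : IntervalIntegrable (fun t => (f t).re) volume a b := ⟨h.1.re, h.2.re⟩
  have him : IntervalIntegrable (fun t => (f t).im) volume a b := ⟨h.1.im, h.2.im⟩
  have h1 := AbsolutelyContinuousOnInterval.contDiff_comp (g := fun x : ℝ => (x : ℂ))
    Complex.ofRealCLM.contDiff
    (hre.absolutelyContinuousOnInterval_intervalIntegral Set.left_mem_uIcc)
  have h2 := AbsolutelyContinuousOnInterval.contDiff_comp (g := fun x : ℝ => (x : ℂ))
    Complex.ofRealCLM.contDiff
    (him.absolutelyContinuousOnInterval_intervalIntegral Set.left_mem_uIcc)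
  refine AbsolutelyContinuousOnInterval.congr
    (AbsolutelyContinuousOnInterval.fun_add h1
      (AbsolutelyContinuousOnInterval.const_smul Complex.I h2)) fun t ht => ?_
  have hsub : IntervalIntegrable f volume a t :=
    h.mono_set (Set.uIcc_subset_uIcc_left ht)
  have hre' : IntervalIntegrable (fun t => ((f t).re : ℂ)) volume a t :=
    ⟨hsub.1.re.ofReal, hsub.2.re.ofReal⟩
  have him' : IntervalIntegrable (fun t => ((f t).im : ℂ)) volume a t :=
    ⟨hsub.1.im.ofReal, hsub.2.im.ofReal⟩
  rw [← intervalIntegral.integral_ofReal, ← intervalIntegral.integral_ofReal, smul_eq_mul,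
    ← intervalIntegral.integral_const_mul, ← intervalIntegral.integral_add hre' (him'.const_mul _)]
  refine intervalIntegral.integral_congr fun s _ => ?_
  rw [mul_comm]
  exact Complex.re_add_im (f s)

theorem sub_le_integral_of_ae_deriv_le {N g : ℝ → ℝ} {T t : ℝ}
    (hN : AbsolutelyContinuousOnInterval N 0 T) (ht : t ∈ Set.Icc 0 T)
    (hg : IntervalIntegrable g volume 0 t)
    (h : ∀ᵐ s, s ∈ Set.Ioo 0 T → deriv N s ≤ g s) :
    N t - N 0 ≤ ∫ s in (0 : ℝ)..t, g s := by
  have hT : 0 ≤ T := ht.1.trans ht.2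
  have hN' : AbsolutelyContinuousOnInterval N 0 t := hN.mono
    (Set.uIcc_subset_uIcc_left (by rwa [Set.uIcc_of_le hT]))
  rw [← hN'.integral_deriv_eq_sub]
  refine intervalIntegral.integral_mono_ae_restrict ht.1 hN'.intervalIntegrable_deriv hg ?_
  rw [Filter.EventuallyLE, ae_restrict_iff' measurableSet_Icc]
  have h0 : ∀ᵐ s : ℝ, s ≠ 0 := by simp [ae_iff, measure_singleton]
  have h1 : ∀ᵐ s : ℝ, s ≠ t := by simp [ae_iff, measure_singleton]
  filter_upwards [h, h0, h1] with s hs hs0 hs1 hmem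
  exact hs ⟨lt_of_le_of_ne hmem.1 hs0.symm, (lt_of_le_of_ne hmem.2 hs1).trans_le ht.2⟩

theorem integral_pow_div_factorial (B c t : ℝ) (j : ℕ) :
    ∫ s in (0 : ℝ)..t, c * (B * ((c * s) ^ j / j.factorial)) =
      B * ((c * t) ^ (j + 1) / (j + 1).factorial) := by
  have : ∀ s : ℝ, c * (B * ((c * s) ^ j / j.factorial)) =
      (c ^ (j + 1) * B / j.factorial) * s ^ j := by
    intro s
    rw [mul_pow]
    ring
  simp only [this]
  rw [intervalIntegral.integral_const_mul, integral_pow, Nat.factorial_succ]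
  have : (j.factorial : ℝ) ≠ 0 := by positivity
  have : (j + 1 : ℝ) ≠ 0 := by positivity
  push_cast
  field_simp
  ring

/-- One step of a hierarchy of differential inequalities `(n²)' ≤ c n g`. -/
theorem le_pow_succ_div_factorial {n g : ℝ → ℝ} {T B c : ℝ} {j : ℕ} (hB : 0 ≤ B) (hc : 0 ≤ c)
    (hn : ∀ t, 0 ≤ n t) (hcont : ContinuousOn n (Set.Icc 0 T)) (hn0 : n 0 = 0)
    (hN : AbsolutelyContinuousOnInterval (fun t => n t ^ 2) 0 T)
    (hderiv : ∀ᵐ t, t ∈ Set.Ioo 0 T → deriv (fun t => n t ^ 2) t ≤ c * (n t * g t))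
    (hg : ∀ t ∈ Set.Icc 0 T, g t ≤ B * ((c * t) ^ j / j.factorial)) :
    ∀ t ∈ Set.Icc 0 T, n t ≤ B * ((c * t) ^ (j + 1) / (j + 1).factorial) := by
  intro t ht
  -- Taking `r` to maximize `n` on [0, t] lets `n s` be replaced by the constant `n r`, so `n`
  -- itself, which may fail to be differentiable at its zeros, is never differentiated. The price is
  -- a factor 2.
  obtain ⟨r, hr, hmax⟩ := isCompact_Icc.exists_isMaxOn (Set.nonempty_Icc.2 ht.1)
    (hcont.mono (Set.Icc_subset_Icc_right ht.2))
  have hrT : r ∈ Set.Icc 0 T := ⟨hr.1, hr.2.trans ht.2⟩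
  have hmono : B * ((c * r) ^ (j + 1) / (j + 1).factorial) ≤
      B * ((c * t) ^ (j + 1) / (j + 1).factorial) := by
    have := hr.1
    have := hr.2
    gcongr
  refine (hmax ⟨ht.1, le_rfl⟩).trans (le_trans ?_ hmono)
  have hNr : AbsolutelyContinuousOnInterval (fun t => n t ^ 2) 0 r := hN.mono
    (Set.uIcc_subset_uIcc_left (by rwa [Set.uIcc_of_le (hrT.1.trans hrT.2)]))
  have key := sub_le_integral_of_ae_deriv_le
    (g := fun s => n r * (c * (B * ((c * s) ^ j / j.factorial)))) hNr ⟨hr.1, le_rfl⟩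
    (by apply Continuous.intervalIntegrable; fun_prop) (by
      filter_upwards [hderiv] with s hs hmem
      have hsT : s ∈ Set.Ioo 0 T := ⟨hmem.1, hmem.2.trans_le hrT.2⟩
      have h1 := hg s ⟨hsT.1.le, hsT.2.le⟩
      have h2 : n s ≤ n r := hmax ⟨hmem.1.le, hmem.2.le.trans hr.2⟩
      have h3 : 0 ≤ B * ((c * s) ^ j / j.factorial) := by
        have := hmem.1.le
        positivity
      calc _ ≤ c * (n s * g s) := hs hsT
        _ ≤ c * (n s * (B * ((c * s) ^ j / j.factorial))) := by
            have := hn s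
            gcongr
        _ ≤ c * (n r * (B * ((c * s) ^ j / j.factorial))) := by gcongr
        _ = _ := by ring)
  rw [intervalIntegral.integral_const_mul, integral_pow_div_factorial, hn0] at key
  rcases (hn r).eq_or_lt with h0 | hpos
  · rw [← h0]
    have := hr.1
    positivity
  · have : n r * n r ≤ n r * (B * ((c * r) ^ (j + 1) / (j + 1).factorial)) := by
      linarith [key]
    exact le_of_mul_le_mul_left this hpos

end Analysis

/-! ### Derivatives of density matrices, correlations and squared norms. -/

section Calculus

variable {ι : Type*} [Fintype ι] [DecidableEq ι]

theorem density_eq_sum (ψ : StateVec ι) :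
    density ψ = ∑ x, ∑ y, (ψ x * star (ψ y)) • Matrix.single x y (1 : ℂ) := by
  rw [Matrix.matrix_eq_sum_single (density ψ)]
  refine Finset.sum_congr rfl fun x _ => Finset.sum_congr rfl fun y _ => ?_
  rw [Matrix.smul_single, smul_eq_mul, mul_one]
  rfl

theorem contDiff_density : ContDiff ℝ 1 (density : StateVec ι → Op ι) := by
  have h : (density : StateVec ι → Op ι) = fun ψ =>
      ∑ x, ∑ y, (ψ x * star (ψ y)) • Matrix.single x y (1 : ℂ) := funext density_eq_sum
  rw [h]
  refine ContDiff.sum fun x _ => ContDiff.sum fun y _ => ContDiff.fun_smul ?_ contDiff_const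
  exact (contDiff_apply ℝ ℂ x).mul ((starL' ℝ (A := ℂ)).contDiff.comp (contDiff_apply ℝ ℂ y))

theorem hasDerivAt_density {ψ : ℝ → StateVec ι} {ψ' : StateVec ι} {t : ℝ}
    (h : HasDerivAt ψ ψ' t) :
    HasDerivAt (fun s => density (ψ s))
      (Matrix.vecMulVec ψ' (star (ψ t)) + Matrix.vecMulVec (ψ t) (star ψ')) t := by
  have h1 : ∀ x, HasDerivAt (fun s => ψ s x) (ψ' x) t := hasDerivAt_pi.1 h
  have h2 : ∀ y, HasDerivAt (fun s => star (ψ s y)) (star (ψ' y)) t := fun y => (h1 y).star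
  have h3 : HasDerivAt (fun s => ∑ x, ∑ y, (ψ s x * star (ψ s y)) • Matrix.single x y (1 : ℂ))
      (∑ x, ∑ y, (ψ' x * star (ψ t y) + ψ t x * star (ψ' y)) • Matrix.single x y (1 : ℂ)) t :=
    HasDerivAt.fun_sum fun x _ => HasDerivAt.fun_sum fun y _ =>
      HasDerivAt.smul_const ((h1 x).mul (h2 y)) (Matrix.single x y (1 : ℂ))
  simp only [← density_eq_sum] at h3
  convert! h3 using 1
  rw [Matrix.matrix_eq_sum_single (_ + _)]
  refine Finset.sum_congr rfl fun x _ => Finset.sum_congr rfl fun y _ => ?_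
  rw [Matrix.smul_single, smul_eq_mul, mul_one]
  rfl

theorem hasDerivAt_density_of_schrodinger {ψ : ℝ → StateVec ι} {H : Op ι} (hH : star H = H)
    {t : ℝ} (h : HasDerivAt ψ (-Complex.I • H.mulVec (ψ t)) t) :
    HasDerivAt (fun s => density (ψ s))
      (-Complex.I • (H * density (ψ t) - density (ψ t) * H)) t := by
  convert hasDerivAt_density h using 1
  rw [density, Matrix.mul_vecMulVec, Matrix.vecMulVec_mul, smul_sub, Matrix.smul_vecMulVec,
    sub_eq_add_neg, star_smul, Matrix.star_mulVec, ← Matrix.star_eq_conjTranspose, hH,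
    Matrix.vecMulVec_smul']
  simp

theorem contDiff_corr (A : Set ι) : ContDiff ℝ 1 (corr A) := by
  have h : ∀ B : Set ι, ContDiff ℝ 1 (condExp (localAlg B) : Op ι → Op ι) := fun B =>
    ((condExp (localAlg B)).restrictScalars ℝ).contDiff
  exact contDiff_id.sub (((h A).mul (h Aᶜ)).const_smul _)

theorem hasDerivAt_corr (A : Set ι) {ρ : ℝ → Op ι} {ρ' : Op ι} {t : ℝ} (h : HasDerivAt ρ ρ' t) :
    HasDerivAt (fun s => corr A (ρ s)) (corrDeriv A (ρ t) ρ') t := by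
  have h1 : ∀ B : Set ι, HasDerivAt (fun s => condExp (localAlg B) (ρ s))
      (condExp (localAlg B) ρ') t := fun B =>
    ((condExp (localAlg B)).restrictScalars ℝ).hasFDerivAt.comp_hasDerivAt t h
  exact h.fun_sub (((h1 A).fun_mul (h1 Aᶜ)).fun_const_smul _)

theorem contDiff_norm_sq_condExp_corr (A s : Set ι) :
    ContDiff ℝ 1 fun ψ : StateVec ι => ‖condExp (localAlg s) (corr A (density ψ))‖ ^ 2 :=
  ContDiff.norm_sq ℂ (((condExp (localAlg s)).restrictScalars ℝ).contDiff.comp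
    ((contDiff_corr A).comp contDiff_density))

theorem hasDerivAt_norm_sq {X : ℝ → Op ι} {X' : Op ι} {t : ℝ} (h : HasDerivAt X X' t) :
    HasDerivAt (fun s => ‖X s‖ ^ 2) (2 * (inner ℂ (X t) X').re) t := by
  have h1 := Complex.reCLM.hasFDerivAt.comp_hasDerivAt t (h.inner ℂ h)
  have h2 : (fun s => ‖X s‖ ^ 2) = Complex.reCLM ∘ fun s => inner ℂ (X s) (X s) := by
    funext s
    exact (inner_self_eq_norm_sq (𝕜 := ℂ) (X s)).symm
  rw [h2]
  convert! h1 using 1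
  rw [← inner_conj_symm X' (X t)]
  simp only [Complex.reCLM_apply, Complex.add_re, Complex.conj_re]
  ring

/-- The other slot already lies in the algebra, so the projection of the derivative can be dropped.
-/
theorem hasDerivAt_norm_sq_condExp (s : Set ι) {X : ℝ → Op ι} {X' : Op ι} {t : ℝ}
    (h : HasDerivAt X X' t) : HasDerivAt (fun r => ‖condExp (localAlg s) (X r)‖ ^ 2)
      (2 * (inner ℂ (condExp (localAlg s) (X t)) X').re) t := by
  have h1 := hasDerivAt_norm_sq
    (((condExp (localAlg s)).restrictScalars ℝ).hasFDerivAt.comp_hasDerivAt t h)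
  convert! h1 using 3
  exact (inner_condExp (condExp_mem _) _).symm

end Calculus

/-! ### Regularity of trajectories. -/

section Evolution

variable {L : ℕ} {T : ℝ} {K : Fin L → ℝ → Op (Fin 1)} {h : Fin (L - 1) → ℝ → Op (Fin 2)}
  {ψ : ℝ → StateVec (Fin L)}

theorem intervalIntegrable_finset_sum {κ : Type*} {s : Finset κ} {f : κ → ℝ → ℂ} {a b : ℝ}
    (hf : ∀ i ∈ s, IntervalIntegrable (f i) volume a b) :
    IntervalIntegrable (fun t => ∑ i ∈ s, f i t) volume a b := by
  have := IntervalIntegrable.sum s hf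
  rwa [Finset.sum_fn] at this

theorem intervalIntegrable_embedOp {κ ι : Type*} (f : κ → ι) {M : ℝ → Op κ} {a b : ℝ}
    (hM : ∀ x y, IntervalIntegrable (fun t => M t x y) volume a b) (x y : Config ι) :
    IntervalIntegrable (fun t => embedOp f (M t) x y) volume a b := by
  by_cases hxy : ∀ j, j ∉ Set.range f → x j = y j
  · simp only [embedOp_apply_of_eq f _ hxy]
    exact hM _ _
  · simp only [embedOp_apply_of_ne f _ hxy]
    exact intervalIntegrable_const

theorem IsUnitChainEvolution.intervalIntegrable_hamiltonian
    (ev : IsUnitChainEvolution L T K h ψ) (x y : Config (Fin L)) :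
    IntervalIntegrable (fun s => chainHamiltonian (fun i => K i s) (fun i => h i s) x y)
      volume 0 T := by
  simp only [chainHamiltonian, Matrix.add_apply, Matrix.sum_apply]
  refine IntervalIntegrable.add (intervalIntegrable_finset_sum fun i _ => ?_)
    (intervalIntegrable_finset_sum fun i _ => ?_)
  · exact intervalIntegrable_embedOp _ (ev.local_integrable i) x y
  · exact intervalIntegrable_embedOp _ (ev.link_integrable i) x y

theorem IsUnitChainEvolution.intervalIntegrable_mulVec
    (ev : IsUnitChainEvolution L T K h ψ) (hT : 0 ≤ T) (x : Config (Fin L)) :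
    IntervalIntegrable
      (fun s => (chainHamiltonian (fun i => K i s) (fun i => h i s)).mulVec (ψ s) x)
      volume 0 T := by
  simp only [Matrix.mulVec, dotProduct]
  refine intervalIntegrable_finset_sum fun y _ => ?_
  refine (ev.intervalIntegrable_hamiltonian x y).mul_continuousOn ?_
  rw [Set.uIcc_of_le hT]
  exact continuousOn_pi.1 ev.continuous y

theorem IsUnitChainEvolution.absolutelyContinuous
    (ev : IsUnitChainEvolution L T K h ψ) (hT : 0 ≤ T) :
    AbsolutelyContinuousOnInterval ψ 0 T := by
  refine AbsolutelyContinuousOnInterval.pi fun x => ?_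
  refine AbsolutelyContinuousOnInterval.congr
    (AbsolutelyContinuousOnInterval.fun_sub (AbsolutelyContinuousOnInterval.const (ψ 0 x) 0 T)
    (AbsolutelyContinuousOnInterval.const_smul Complex.I
      (absolutelyContinuousOnInterval_integral_complex (ev.intervalIntegrable_mulVec hT x))))
    fun t ht => ?_
  rw [Set.uIcc_of_le hT] at ht
  rw [ev.schrodinger t ht x, smul_eq_mul]

/-- Lebesgue differentiation of the integral equation; with merely integrable controls the
Schrödinger equation holds pointwise only almost everywhere. -/
theorem IsUnitChainEvolution.ae_hasDerivAt
    (ev : IsUnitChainEvolution L T K h ψ) (hT : 0 ≤ T) :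
    ∀ᵐ t, t ∈ Set.Ioo 0 T → HasDerivAt ψ
      (-Complex.I • (chainHamiltonian (fun i => K i t) (fun i => h i t)).mulVec (ψ t)) t := by
  have h1 : ∀ᵐ t, ∀ x, t ∈ Set.uIcc 0 T → ∀ c ∈ Set.uIcc 0 T, HasDerivAt (fun r => ∫ s in c..r,
      (chainHamiltonian (fun i => K i s) (fun i => h i s)).mulVec (ψ s) x)
      ((chainHamiltonian (fun i => K i t) (fun i => h i t)).mulVec (ψ t) x) t :=
    ae_all_iff.2 fun x => (ev.intervalIntegrable_mulVec hT x).ae_hasDerivAt_integral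
  filter_upwards [h1] with t ht hmem
  rw [Set.uIcc_of_le hT] at ht
  refine hasDerivAt_pi.2 fun x => ?_
  have h2 := ((ht x (Set.Ioo_subset_Icc_self hmem) 0 ⟨le_rfl, hT⟩).const_mul
    Complex.I).const_sub (ψ 0 x)
  have h3 : (fun r => ψ r x) =ᶠ[nhds t] fun r => ψ 0 x - Complex.I * ∫ s in (0 : ℝ)..r,
      (chainHamiltonian (fun i => K i s) (fun i => h i s)).mulVec (ψ s) x := by
    filter_upwards [isOpen_Ioo.mem_nhds hmem] with r hr
    exact ev.schrodinger r (Set.Ioo_subset_Icc_self hr) x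
  convert! h2.congr_of_eventuallyEq h3 using 1
  simp

theorem star_chainHamiltonian {K : Fin L → Op (Fin 1)} {h : Fin (L - 1) → Op (Fin 2)}
    (hK : ∀ i, (K i).IsHermitian) (hh : ∀ i, (h i).IsHermitian) :
    star (chainHamiltonian K h) = chainHamiltonian K h := by
  simp only [chainHamiltonian, star_add, star_sum, star_embedOp]
  congr 1
  · exact Finset.sum_congr rfl fun i _ => congrArg _ (hK i)
  · exact Finset.sum_congr rfl fun i _ => congrArg _ (hh i)

end Evolution

/-! ### Contribution of a single Hamiltonian term. -/

section Terms

variable {ι κ : Type*} [Fintype ι] [DecidableEq ι] [Fintype κ] [DecidableEq κ] {f : κ → ι}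

/-- The contribution of the commutator with `a` to half the derivative of the squared norm of the
correlations inside `s`. -/
def corrRate (A s : Set ι) (ρ a : Op ι) : ℝ :=
  (inner ℂ (condExp (localAlg s) (corr A ρ)) (corrDeriv A ρ (a * ρ - ρ * a))).im

theorem corrRate_add (A s : Set ι) (ρ a b : Op ι) :
    corrRate A s ρ (a + b) = corrRate A s ρ a + corrRate A s ρ b := by
  have h : (a + b) * ρ - ρ * (a + b) = (a * ρ - ρ * a) + (b * ρ - ρ * b) := by
    rw [add_mul, mul_add]
    abel
  rw [corrRate, h, corrDeriv_add, inner_add_right, Complex.add_im]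
  rfl

theorem corrRate_sum {α : Type*} (A s : Set ι) (ρ : Op ι) (t : Finset α) (a : α → Op ι) :
    corrRate A s ρ (∑ i ∈ t, a i) = ∑ i ∈ t, corrRate A s ρ (a i) := by
  classical
  induction t using Finset.induction_on with
  | empty =>
    have := corrRate_add A s ρ 0 0
    simp only [Finset.sum_empty]
    rw [add_zero] at this
    linarith
  | insert i t hi ih => rw [Finset.sum_insert hi, Finset.sum_insert hi, corrRate_add, ih]

theorem re_inner_corrDeriv (A s : Set ι) (ρ a : Op ι) :
    (inner ℂ (condExp (localAlg s) (corr A ρ))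
      (corrDeriv A ρ (-Complex.I • (a * ρ - ρ * a)))).re = corrRate A s ρ a := by
  rw [corrDeriv_smul, inner_smul_right, corrRate]
  simp

theorem corrDeriv_commutator (hf : Function.Injective f) {A : Set ι}
    (hA : Set.range f ⊆ A ∨ Set.range f ⊆ Aᶜ) (M : Op κ) (ρ : Op ι) :
    corrDeriv A ρ (embedOp f M * ρ - ρ * embedOp f M) =
      embedOp f M * corr A ρ - corr A ρ * embedOp f M :=
  hA.elim (fun h => corrDeriv_commutator_of_subset hf h M ρ)
    fun h => corrDeriv_commutator_of_subset_compl hf h M ρ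

theorem corrRate_of_subset (hf : Function.Injective f) {A s : Set ι}
    (hA : Set.range f ⊆ A ∨ Set.range f ⊆ Aᶜ) (hs : Set.range f ⊆ s) {M : Op κ}
    (hM : M.IsHermitian) (ρ : Op ι) : corrRate A s ρ (embedOp f M) = 0 := by
  rw [corrRate, corrDeriv_commutator hf hA]
  exact im_inner_condExp_commutator_of_subset hf hs hM _

theorem corrRate_of_disjoint (hf : Function.Injective f) {A s : Set ι}
    (hs : Disjoint (Set.range f) s) (M : Op κ) (ρ : Op ι) :
    corrRate A s ρ (embedOp f M) = 0 := by
  rw [corrRate, inner_corrDeriv_commutator_of_disjoint hf hs M (condExp_mem _), Complex.zero_im]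

theorem corrRate_le (hf : Function.Injective f) {A s t : Set ι}
    (hA : Set.range f ⊆ A ∨ Set.range f ⊆ Aᶜ) (hst : s ⊆ t) (ht : Set.range f ⊆ t) {M : Op κ}
    (hM : M.IsHermitian) (ρ : Op ι) :
    corrRate A s ρ (embedOp f M) ≤ 2 * ‖M‖ *
      (‖condExp (localAlg s) (corr A ρ)‖ * ‖condExp (localAlg t) (corr A ρ)‖) := by
  rw [corrRate, corrDeriv_commutator hf hA]
  exact (le_abs_self _).trans ((Complex.abs_im_le_norm _).trans
    (norm_inner_condExp_commutator_le hf hst ht hM _))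

end Terms

/-! ### Counting the links that contribute. -/

section Chain

variable {L : ℕ}

/-- The `k` leftmost and the `k` rightmost sites of the chain. -/
def outer (L k : ℕ) : Set (Fin L) := {j | j.1 < k ∨ L - k ≤ j.1}

/-- The left half of the chain. -/
def leftHalf (L : ℕ) : Set (Fin L) := {j | j.1 < L / 2}

theorem outer_mono (k : ℕ) : outer L k ⊆ outer L (k + 1) := by
  intro j hj
  simp only [outer, Set.mem_ofPred_eq] at hj ⊢
  omega

theorem link_injective (i : Fin (L - 1)) :
    Function.Injective ![linkLeft i, linkRight i] := by
  have h : linkLeft i ≠ linkRight i := by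
    intro h
    have := congrArg Fin.val h
    simp only [linkLeft, linkRight] at this
    omega
  intro a b hab
  fin_cases a <;> fin_cases b <;> simp_all [eq_comm]

theorem range_link (i : Fin (L - 1)) :
    Set.range ![linkLeft i, linkRight i] = {linkLeft i, linkRight i} := by
  rw [Matrix.range_cons, Matrix.range_cons, Matrix.range_empty, Set.union_empty]
  rfl

theorem corrRate_site (k : ℕ) (i : Fin L) {M : Op (Fin 1)} (hM : M.IsHermitian)
    (ρ : Op (Fin L)) : corrRate (leftHalf L) (outer L k) ρ (embedOp (fun _ => i) M) = 0 := by
  have hf : Function.Injective (fun _ : Fin 1 => i) := Function.injective_of_subsingleton _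
  have hr : Set.range (fun _ : Fin 1 => i) = {i} := Set.range_const
  by_cases hi : i ∈ outer L k
  · refine corrRate_of_subset hf ?_ (by simpa [hr] using hi) hM ρ
    rw [hr, Set.singleton_subset_iff, Set.singleton_subset_iff]
    exact em _
  · exact corrRate_of_disjoint hf (by simpa [hr] using hi) M ρ

theorem corrRate_link {k : ℕ} (hk : k + 1 ≤ L / 2) (i : Fin (L - 1)) {M : Op (Fin 2)}
    (hM : M.IsHermitian) (hM1 : hsNorm M ≤ 1) (ρ : Op (Fin L)) :
    corrRate (leftHalf L) (outer L k) ρ (embedOp ![linkLeft i, linkRight i] M) ≤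
      if i.1 + 1 = k ∨ i.1 + 1 = L - k then
        2 * (‖condExp (localAlg (outer L k)) (corr (leftHalf L) ρ)‖ *
          ‖condExp (localAlg (outer L (k + 1))) (corr (leftHalf L) ρ)‖)
      else 0 := by
  have hf := link_injective i
  have hi := i.2
  have hsub : ∀ s : Set (Fin L), linkLeft i ∈ s → linkRight i ∈ s →
      Set.range ![linkLeft i, linkRight i] ⊆ s := by
    intro s h1 h2
    rw [range_link]
    rintro j (rfl | rfl)
    exacts [h1, h2]
  -- The link with `i.1 + 1 = L / 2` is the only one crossing the cut. Since `k + 1 ≤ L / 2`, it is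
  -- disjoint from `outer L k` and falls to the last case below.
  have hA : i.1 + 1 ≠ L / 2 → Set.range ![linkLeft i, linkRight i] ⊆ leftHalf L ∨
      Set.range ![linkLeft i, linkRight i] ⊆ (leftHalf L)ᶜ := by
    intro hne
    by_cases h : i.1 + 1 < L / 2
    · left
      apply hsub <;> simp only [leftHalf, linkLeft, linkRight, Set.mem_ofPred_eq] <;> omega
    · right
      apply hsub <;>
        simp only [leftHalf, linkLeft, linkRight, Set.mem_compl_iff, Set.mem_ofPred_eq] <;> omega
  split_ifs with hb
  · have h := corrRate_le hf (hA (by omega)) (outer_mono k) (hsub _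
      (by simp only [outer, linkLeft, Set.mem_ofPred_eq]; omega)
      (by simp only [outer, linkRight, Set.mem_ofPred_eq]; omega)) hM ρ
    refine h.trans ?_
    rw [← hsNorm_eq_norm]
    have h0 : 0 ≤ ‖condExp (localAlg (outer L k)) (corr (leftHalf L) ρ)‖ *
          ‖condExp (localAlg (outer L (k + 1))) (corr (leftHalf L) ρ)‖ := by positivity
    nlinarith
  · by_cases hin : i.1 + 1 < k ∨ L - k ≤ i.1
    · refine (corrRate_of_subset hf (hA (by omega)) (hsub _ ?_ ?_) hM ρ).le
      · simp only [outer, linkLeft, Set.mem_ofPred_eq]; omega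
      · simp only [outer, linkRight, Set.mem_ofPred_eq]; omega
    · refine (corrRate_of_disjoint hf ?_ M ρ).le
      rw [range_link, Set.disjoint_left]
      rintro j (rfl | rfl) <;> simp only [outer, linkLeft, linkRight, Set.mem_ofPred_eq] <;> omega

theorem sum_boundary_le (k : ℕ) {c : ℝ} (hc : 0 ≤ c) :
    (∑ i : Fin (L - 1), if i.1 + 1 = k ∨ i.1 + 1 = L - k then c else 0) ≤ 2 * c := by
  have hone : ∀ r : ℕ, (Finset.univ.filter fun i : Fin (L - 1) => i.1 + 1 = r).card ≤ 1 := by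
    intro r
    refine Finset.card_le_one.2 fun a ha b hb => Fin.ext ?_
    have h1 := (Finset.mem_filter.1 ha).2
    have h2 := (Finset.mem_filter.1 hb).2
    omega
  rw [← Finset.sum_filter, Finset.sum_const, nsmul_eq_mul]
  refine mul_le_mul_of_nonneg_right ?_ hc
  have : (Finset.univ.filter fun i : Fin (L - 1) => i.1 + 1 = k ∨ i.1 + 1 = L - k).card ≤ 2 := by
    rw [Finset.filter_or]
    exact (Finset.card_union_le _ _).trans (Nat.add_le_add (hone k) (hone (L - k)))
  exact_mod_cast this

/-- The constant 4 is two boundary links times the 2 from the commutator; differentiating a square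
later doubles it to 8. -/
theorem corrRate_chainHamiltonian_le {k : ℕ} (hk : k + 1 ≤ L / 2) {K : Fin L → Op (Fin 1)}
    {h : Fin (L - 1) → Op (Fin 2)} (hK : ∀ i, (K i).IsHermitian) (hh : ∀ i, (h i).IsHermitian)
    (hh1 : ∀ i, hsNorm (h i) ≤ 1) (ρ : Op (Fin L)) :
    corrRate (leftHalf L) (outer L k) ρ (chainHamiltonian K h) ≤
      4 * (‖condExp (localAlg (outer L k)) (corr (leftHalf L) ρ)‖ *
          ‖condExp (localAlg (outer L (k + 1))) (corr (leftHalf L) ρ)‖) := by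
  rw [chainHamiltonian, corrRate_add, corrRate_sum, corrRate_sum,
    Finset.sum_eq_zero fun i _ => corrRate_site k i (hK i) ρ, zero_add]
  refine (Finset.sum_le_sum fun i _ => corrRate_link hk i (hh i) (hh1 i) ρ).trans ?_
  refine (sum_boundary_le k (by positivity)).trans (le_of_eq ?_)
  ring

end Chain

/-! ### Pure and product states. -/

section Density

variable {ι : Type*}

theorem star_density (ψ : StateVec ι) : star (density ψ) = density ψ := by
  ext x y
  simp [density, Matrix.star_apply, Matrix.vecMulVec_apply, mul_comm]

variable [Fintype ι]

theorem IsProductState.exists_density_eq {ψ : StateVec ι} (h : IsProductState ψ) :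
    ∃ p : ι → Matrix (Fin 2) (Fin 2) ℂ, (∀ i, (p i).trace = 1) ∧ density ψ = tensorOp p := by
  obtain ⟨v, hv, hψ⟩ := h
  refine ⟨fun i => Matrix.vecMulVec (v i) (star (v i)), fun i => ?_, ?_⟩
  · rw [Matrix.trace_vecMulVec, dotProduct]
    have := congrArg (fun r : ℝ => (r : ℂ)) (hv i)
    push_cast at this
    rw [← this]
    refine Finset.sum_congr rfl fun x _ => ?_
    rw [Pi.star_apply, RCLike.star_def, Complex.mul_conj']
  · ext x y
    simp [density, Matrix.vecMulVec_apply, tensorOp_apply, hψ, Finset.prod_mul_distrib]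

variable [DecidableEq ι]

theorem trace_density (ψ : StateVec ι) : (density ψ).trace = ((∑ x, ‖ψ x‖ ^ 2 : ℝ) : ℂ) := by
  rw [density, Matrix.trace_vecMulVec, dotProduct]
  push_cast
  refine Finset.sum_congr rfl fun x _ => ?_
  rw [Pi.star_apply, RCLike.star_def, Complex.mul_conj']

theorem norm_density (ψ : StateVec ι) : ‖density ψ‖ = ∑ x, ‖ψ x‖ ^ 2 := by
  rw [← sq_eq_sq₀ (norm_nonneg _) (by positivity), norm_sq_eq_sum, sq, Finset.sum_mul_sum]
  refine Finset.sum_congr rfl fun x _ => Finset.sum_congr rfl fun y _ => ?_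
  rw [density, Matrix.vecMulVec_apply, norm_mul, mul_pow, Pi.star_apply, _root_.norm_star]

theorem density_mul_self {ψ : StateVec ι} (h : ‖density ψ‖ = 1) :
    density ψ * density ψ = density ψ := by
  have h1 := trace_density ψ
  rw [← norm_density, h, density, Matrix.trace_vecMulVec, dotProduct_comm] at h1
  rw [density, Matrix.vecMulVec_mul_vecMulVec, h1]
  simp

theorem IsProductState.norm_density_eq_one {ψ : StateVec ι} (h : IsProductState ψ) :
    ‖density ψ‖ = 1 := by
  obtain ⟨p, hp, hψ⟩ := h.exists_density_eq
  have h1 := trace_density ψ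
  rw [← norm_density, hψ, trace_tensorOp, Finset.prod_congr rfl fun i _ => hp i,
    Finset.prod_const_one] at h1
  rw [hψ]
  exact_mod_cast h1.symm

end Density

/-! ### Conservation of norm and the finite-speed bound. -/

section Evolution

variable {L : ℕ} {T : ℝ} {K : Fin L → ℝ → Op (Fin 1)} {h : Fin (L - 1) → ℝ → Op (Fin 2)}
  {ψ : ℝ → StateVec (Fin L)}

theorem IsUnitChainEvolution.ae_hasDerivAt_density
    (ev : IsUnitChainEvolution L T K h ψ) (hT : 0 ≤ T) :
    ∀ᵐ t, t ∈ Set.Ioo 0 T → HasDerivAt (fun s => density (ψ s))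
      (-Complex.I • (chainHamiltonian (fun i => K i t) (fun i => h i t) * density (ψ t) -
        density (ψ t) * chainHamiltonian (fun i => K i t) (fun i => h i t))) t := by
  filter_upwards [ev.ae_hasDerivAt hT] with t ht hmem
  have hmem' := Set.Ioo_subset_Icc_self hmem
  exact hasDerivAt_density_of_schrodinger (star_chainHamiltonian
    (fun i => ev.local_hermitian i t hmem') fun i => ev.link_hermitian i t hmem') (ht hmem)

theorem IsUnitChainEvolution.norm_density_eq_one
    (ev : IsUnitChainEvolution L T K h ψ) (hψ : IsProductState (ψ 0)) {t : ℝ}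
    (ht : t ∈ Set.Icc 0 T) : ‖density (ψ t)‖ = 1 := by
  have hT : 0 ≤ T := ht.1.trans ht.2
  have hac : AbsolutelyContinuousOnInterval (fun t => ‖density (ψ t)‖ ^ 2) 0 T :=
    AbsolutelyContinuousOnInterval.contDiff_comp (f := ψ) (g := fun φ => ‖density φ‖ ^ 2)
      (ContDiff.norm_sq ℂ contDiff_density)
      (ev.absolutelyContinuous hT)
  have hd : ∀ᵐ s, s ∈ Set.Ioo 0 T → deriv (fun t => ‖density (ψ t)‖ ^ 2) s = 0 := by
    filter_upwards [ev.ae_hasDerivAt_density hT] with s hs hmem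
    have hmem' := Set.Ioo_subset_Icc_self hmem
    rw [(hasDerivAt_norm_sq (hs hmem)).deriv, inner_smul_right]
    have := inner_commutator_self_im (star_chainHamiltonian
      (fun i => ev.local_hermitian i s hmem') fun i => ev.link_hermitian i s hmem') (density (ψ s))
    simp [this]
  -- The one-sided estimate is applied to the squared norm and to its negative to obtain constancy.
  have h1 := sub_le_integral_of_ae_deriv_le (g := fun _ => 0) hac ht
    intervalIntegrable_const (hd.mono fun s hs hmem => (hs hmem).le)
  have h2 := sub_le_integral_of_ae_deriv_le (g := fun _ => 0)
    (AbsolutelyContinuousOnInterval.fun_neg hac) ht intervalIntegrable_const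
    (hd.mono fun s hs hmem => by rw [deriv.fun_neg, hs hmem, neg_zero])
  rw [hψ.norm_density_eq_one] at h1 h2
  simp only [intervalIntegral.integral_zero] at h1 h2
  have h3 : ‖density (ψ t)‖ ^ 2 = 1 := by linarith
  exact (pow_eq_one_iff_of_nonneg (norm_nonneg _) two_ne_zero).1 h3

/-- Correlations between the two ends of the chain build up at most at a finite speed. -/
theorem IsUnitChainEvolution.norm_corr_outer_le
    (ev : IsUnitChainEvolution L T K h ψ) (hψ : IsProductState (ψ 0)) :
    ∀ j ≤ L / 2, ∀ t ∈ Set.Icc 0 T,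
      ‖condExp (localAlg (outer L (L / 2 - j))) (corr (leftHalf L) (density (ψ t)))‖ ≤
        (1 + 2 ^ L) * ((8 * t) ^ j / j.factorial) := by
  intro j
  induction j with
  -- No dynamics enters at the full width `L / 2`; each later step narrows both end blocks by one
  -- site and gains one integration.
  | zero =>
    intro _ t ht
    refine (norm_condExp_le _).trans ((norm_corr_le _ _).trans ?_)
    rw [ev.norm_density_eq_one hψ ht]
    simp
  | succ j ih =>
    intro hj t ht
    have hT : 0 ≤ T := ht.1.trans ht.2
    have hk : L / 2 - (j + 1) + 1 = L / 2 - j := by omega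
    have hac : AbsolutelyContinuousOnInterval (fun t => ‖condExp (localAlg
        (outer L (L / 2 - (j + 1)))) (corr (leftHalf L) (density (ψ t)))‖ ^ 2) 0 T :=
      AbsolutelyContinuousOnInterval.contDiff_comp (f := ψ)
        (g := fun φ => ‖condExp (localAlg (outer L (L / 2 - (j + 1))))
          (corr (leftHalf L) (density φ))‖ ^ 2)
        (contDiff_norm_sq_condExp_corr (leftHalf L) (outer L (L / 2 - (j + 1))))
        (ev.absolutelyContinuous hT)
    refine le_pow_succ_div_factorial (n := fun t => ‖condExp (localAlg
      (outer L (L / 2 - (j + 1)))) (corr (leftHalf L) (density (ψ t)))‖) (by positivity)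
      (by norm_num) (fun t => norm_nonneg _) ?_ ?_ hac ?_ (ih (by omega)) t ht
    · have h1 : Continuous fun φ : StateVec (Fin L) => ‖condExp (localAlg
          (outer L (L / 2 - (j + 1)))) (corr (leftHalf L) (density φ))‖ :=
        ((condExp _).continuous.comp
          ((contDiff_corr _).continuous.comp contDiff_density.continuous)).norm
      exact h1.comp_continuousOn ev.continuous
    · obtain ⟨p, hp, hpψ⟩ := hψ.exists_density_eq
      simp only [hpψ]
      rw [corr_tensorOp _ hp, map_zero, norm_zero]
    · filter_upwards [ev.ae_hasDerivAt_density hT] with s hs hmem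
      have hmem' := Set.Ioo_subset_Icc_self hmem
      rw [(hasDerivAt_norm_sq_condExp _ (hasDerivAt_corr (leftHalf L) (hs hmem))).deriv,
        re_inner_corrDeriv]
      have := corrRate_chainHamiltonian_le (k := L / 2 - (j + 1)) (by omega)
        (fun i => ev.local_hermitian i s hmem') (fun i => ev.link_hermitian i s hmem')
        (fun i => ev.link_strength i s hmem') (density (ψ s))
      rw [hk] at this
      linarith

end Evolution

/-! ### One-qubit marginals and pair correlations. -/

section Marginals

variable {ι : Type*} [Fintype ι] [DecidableEq ι]

/-- The expectation values of the matrix units of the qubit `i` (the transposed reduced state). -/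
def siteExp (i : ι) (ρ : Op ι) : Matrix (Fin 2) (Fin 2) ℂ :=
  Matrix.of fun p q => (siteOp i (Matrix.single p q 1) * ρ).trace

theorem siteOp_eq_sum (i : ι) (u : Matrix (Fin 2) (Fin 2) ℂ) :
    siteOp i u = ∑ p, ∑ q, u p q • siteOp i (Matrix.single p q 1) := by
  have h := congrArg (siteLin i) (Matrix.matrix_eq_sum_single u)
  simp only [map_sum] at h
  refine h.trans (Finset.sum_congr rfl fun p _ => Finset.sum_congr rfl fun q _ => ?_)
  have hs : Matrix.single p q (u p q) = u p q • Matrix.single p q 1 := by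
    rw [Matrix.smul_single, smul_eq_mul, mul_one]
  rw [hs, map_smul]
  rfl

theorem norm_trace_siteOp_mul_le (i : ι) (u : Matrix (Fin 2) (Fin 2) ℂ) {ψ : StateVec ι}
    (h : ‖density ψ‖ = 1) : ‖(siteOp i u * density ψ).trace‖ ≤ ‖u‖ := by
  have h1 : (siteOp i u * density ψ).trace = inner ℂ (density ψ) (siteOp i u * density ψ) := by
    rw [inner_eq_trace, star_density, Matrix.trace_mul_comm (density ψ), mul_assoc,
      density_mul_self h]
  rw [h1]
  refine (norm_inner_le_norm _ _).trans ?_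
  have := norm_siteOp_mul_le i u (density ψ)
  rw [h] at this ⊢
  linarith

theorem norm_siteExp_le (i : ι) {ψ : StateVec ι} (h : ‖density ψ‖ = 1) :
    ‖siteExp i (density ψ)‖ ≤ 1 := by
  set α := siteExp i (density ψ) with hα
  -- Testing with the entrywise conjugate of `α` turns the expectation bound into ‖α‖² ≤ ‖α‖.
  have h1 : (siteOp i (α.map star) * density ψ).trace = ((‖α‖ ^ 2 : ℝ) : ℂ) := by
    rw [siteOp_eq_sum, norm_sq_eq_sum]
    simp only [Finset.sum_mul, Matrix.trace_sum, Matrix.smul_mul, Matrix.trace_smul]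
    push_cast
    refine Finset.sum_congr rfl fun p _ => Finset.sum_congr rfl fun q _ => ?_
    change star (α p q) * α p q = _
    rw [RCLike.star_def, Complex.conj_mul']
  have h2 := norm_trace_siteOp_mul_le i (α.map star) h
  rw [h1, Complex.norm_real, Real.norm_of_nonneg (by positivity),
    Matrix.frobenius_norm_map_eq α star fun a => _root_.norm_star a] at h2
  nlinarith [norm_nonneg α]

theorem tensorOp_extend_pair {i j : ι} (hij : i ≠ j) (p : Fin 2 → Matrix (Fin 2) (Fin 2) ℂ) :
    tensorOp (Function.extend ![i, j] p 1) = siteOp i (p 0) * siteOp j (p 1) := by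
  have hf : Function.Injective ![i, j] := by
    intro a b hab
    fin_cases a <;> fin_cases b <;> simp_all [eq_comm]
  rw [siteOp, siteOp, tensorOp_mul]
  congr 1
  funext k
  rw [Pi.mul_apply]
  by_cases hi : k = i
  · subst hi
    rw [Pi.mulSingle_eq_same, Pi.mulSingle_eq_of_ne hij, mul_one]
    exact hf.extend_apply p 1 0
  by_cases hj : k = j
  · subst hj
    rw [Pi.mulSingle_eq_same, Pi.mulSingle_eq_of_ne hi, one_mul]
    exact hf.extend_apply p 1 1
  rw [Pi.mulSingle_eq_of_ne hi, Pi.mulSingle_eq_of_ne hj, mul_one, Function.extend_apply']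
  · rfl
  · rintro ⟨a, ha⟩
    fin_cases a
    exacts [hi ha.symm, hj ha.symm]

theorem trace_mul_condExp {S : StarSubalgebra ℂ (Op ι)} {X : Op ι} (hX : X ∈ S) (Y : Op ι) :
    (X * condExp S Y).trace = (X * Y).trace := by
  have := inner_condExp (star_mem hX) Y
  rwa [inner_eq_trace, inner_eq_trace, star_star] at this

/-- Reordering collects everything on `A` in one factor and everything on its complement in the
other; independence under the normalized trace then splits the expectation. -/
theorem trace_siteOp_mul_siteOp_mul {A : Set ι} {i j : ι} (hi : i ∈ A) (hj : j ∈ Aᶜ)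
    (u v : Matrix (Fin 2) (Fin 2) ℂ) (ρ : Op ι) :
    (siteOp i u * siteOp j v * (condExp (localAlg A) ρ * condExp (localAlg Aᶜ) ρ)).trace =
      (siteOp i u * ρ).trace * (siteOp j v * ρ).trace / 2 ^ Fintype.card ι := by
  have hu := siteOp_mem_localAlg hi u
  have hv := siteOp_mem_localAlg hj v
  have hc : siteOp j v * condExp (localAlg A) ρ = condExp (localAlg A) ρ * siteOp j v :=
    mem_localAlg_iff.1 (condExp_mem ρ) j hj v
  have h1 : siteOp i u * siteOp j v * (condExp (localAlg A) ρ * condExp (localAlg Aᶜ) ρ) =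
      siteOp i u * condExp (localAlg A) ρ * (siteOp j v * condExp (localAlg Aᶜ) ρ) := by
    rw [mul_assoc, ← mul_assoc (siteOp j v), hc]
    simp only [mul_assoc]
  rw [h1, trace_mul_of_mem_compl (mul_mem hu (condExp_mem ρ)) (mul_mem hv (condExp_mem ρ)),
    trace_mul_condExp hu, trace_mul_condExp hv]

theorem trace_embedOp_pair_mul_corr {A : Set ι} {i j : ι} (hi : i ∈ A) (hj : j ∈ Aᶜ)
    (M : Op (Fin 2)) (ρ : Op ι) :
    (embedOp ![i, j] M * corr A ρ).trace = (embedOp ![i, j] M * ρ).trace -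
      ∑ a, ∑ b, M a b * (siteExp i ρ (a 0) (b 0) * siteExp j ρ (a 1) (b 1)) := by
  have hij : i ≠ j := by
    rintro rfl
    exact hj hi
  have hf : Function.Injective ![i, j] := by
    intro a b hab
    fin_cases a <;> fin_cases b <;> simp_all [eq_comm]
  rw [corr, mul_sub, Matrix.trace_sub]
  congr 1
  rw [Matrix.mul_smul, Matrix.trace_smul, embedOp_eq_sum hf]
  simp only [Finset.sum_mul, Matrix.trace_sum, Finset.smul_sum]
  refine Finset.sum_congr rfl fun a _ => Finset.sum_congr rfl fun b _ => ?_
  rw [Matrix.smul_mul, Matrix.trace_smul, tensorOp_extend_pair hij,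
    trace_siteOp_mul_siteOp_mul hi hj]
  simp only [siteExp, Matrix.of_apply, smul_eq_mul]
  field_simp

end Marginals

/-! ### Overlap of product states with maximally entangled states. -/

section MaxEntangled

theorem IsMaxEntangled.trace_siteOp_mul {φ : StateVec (Fin 2)} (h : IsMaxEntangled φ) (q : Fin 2)
    (u : Matrix (Fin 2) (Fin 2) ℂ) : (siteOp q u * density φ).trace = u.trace / 2 := by
  rw [siteOp_eq_embedOp, trace_embedOp_mul, h q, Matrix.mul_smul, mul_one, Matrix.trace_smul,
    trace_tensorOp]
  simp
  ring

theorem IsMaxEntangled.norm_density_eq_one {φ : StateVec (Fin 2)} (h : IsMaxEntangled φ) :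
    ‖density φ‖ = 1 := by
  have h1 := h.trace_siteOp_mul 0 1
  rw [siteOp_one, one_mul, trace_density, ← norm_density, Matrix.trace_one] at h1
  have h2 : ((‖density φ‖ : ℝ) : ℂ) = ((1 : ℝ) : ℂ) := by
    rw [h1]
    simp
  exact_mod_cast h2

theorem IsMaxEntangled.norm_siteOp_mul_sq {φ : StateVec (Fin 2)} (h : IsMaxEntangled φ)
    (q : Fin 2) (u : Matrix (Fin 2) (Fin 2) ℂ) :
    ‖siteOp q u * density φ‖ ^ 2 = ‖u‖ ^ 2 / 2 := by
  have h1 : inner ℂ (siteOp q u * density φ) (siteOp q u * density φ) = inner ℂ u u / 2 := by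
    rw [inner_mul_left_eq, ← mul_assoc, star_siteOp, siteOp_mul, inner_eq_trace, star_density,
      Matrix.trace_mul_comm, mul_assoc, density_mul_self h.norm_density_eq_one,
      h.trace_siteOp_mul, inner_eq_trace]
  rw [inner_self_eq, inner_self_eq] at h1
  exact_mod_cast h1

/-- The singlet fraction of a product state is at most `1/2`. -/
theorem IsMaxEntangled.norm_sum_le {φ : StateVec (Fin 2)} (h : IsMaxEntangled φ)
    {α β : Matrix (Fin 2) (Fin 2) ℂ} (hα : ‖α‖ ≤ 1) (hβ : ‖β‖ ≤ 1) :
    ‖∑ a, ∑ b, density φ a b * (α (a 0) (b 0) * β (a 1) (b 1))‖ ≤ 1 / 2 := by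
  -- The sum is the expectation of αᵀ ⊗ βᵀ in φ. Put one factor on each side of an inner product: as
  -- the marginals of φ are maximally mixed, each side has squared norm at most 1/2, and
  -- Cauchy–Schwarz finishes.
  have h1 : ∑ a, ∑ b, density φ a b * (α (a 0) (b 0) * β (a 1) (b 1)) =
      inner ℂ (siteOp 0 (star α.transpose) * density φ)
        (siteOp 1 β.transpose * density φ) := by
    have hext : Function.extend ![(0 : Fin 2), 1] ![α.transpose, β.transpose] 1 =
        ![α.transpose, β.transpose] := by
      have hid : ![(0 : Fin 2), 1] = id := by
        funext k
        fin_cases k <;> rfl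
      rw [hid]
      exact Function.extend_id _ _
    have ht := tensorOp_extend_pair (i := (0 : Fin 2)) (j := 1) (by decide)
      ![α.transpose, β.transpose]
    rw [hext] at ht
    rw [inner_mul_left_eq, inner_eq_trace, star_siteOp, star_star, star_density,
      Matrix.trace_mul_comm, mul_assoc, mul_assoc, density_mul_self h.norm_density_eq_one,
      ← mul_assoc]
    change _ = (siteOp 0 (![α.transpose, β.transpose] 0) *
      siteOp 1 (![α.transpose, β.transpose] 1) * density φ).trace
    rw [← ht, Matrix.trace_mul_comm]
    simp only [Matrix.trace, Matrix.diag_apply, Matrix.mul_apply, tensorOp_apply,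
      Fin.prod_univ_two]
    rfl
  rw [h1]
  refine (norm_inner_le_norm _ _).trans ?_
  have h2 := h.norm_siteOp_mul_sq 0 (star α.transpose)
  have h3 := h.norm_siteOp_mul_sq 1 β.transpose
  rw [frobenius_norm_star, Matrix.frobenius_norm_transpose] at h2
  rw [Matrix.frobenius_norm_transpose] at h3
  have h4 : ‖α‖ ^ 2 ≤ 1 := pow_le_one₀ (norm_nonneg _) hα
  have h5 : ‖β‖ ^ 2 ≤ 1 := pow_le_one₀ (norm_nonneg _) hβ
  nlinarith [sq_nonneg (‖siteOp 0 (star α.transpose) * density φ‖ -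
    ‖siteOp 1 β.transpose * density φ‖)]

/-- Attainment of the supremum is not needed: any threshold strictly between 1/2 and 1 separates the
state from product states. -/
theorem exists_isMaxEntangled_of_singletFraction {ρ : Op (Fin 2)} (h : singletFraction ρ = 1) :
    ∃ φ, IsMaxEntangled φ ∧ 3 / 4 < (density φ * ρ).trace.re := by
  rw [singletFraction] at h
  have hne : {r : ℝ | ∃ φ : StateVec (Fin 2), IsMaxEntangled φ ∧
      r = (star φ ⬝ᵥ (ρ.mulVec φ)).re}.Nonempty := by
    -- The real supremum of the empty set is 0 by convention, so the value 1 excludes emptiness.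
    by_contra hemp
    rw [Set.not_nonempty_iff_eq_empty.1 hemp, Real.sSup_empty] at h
    exact zero_ne_one h
  obtain ⟨_, ⟨φ, hφ, rfl⟩, hr⟩ := exists_lt_of_lt_csSup hne (show 3 / 4 < sSup _ by
    rw [h]; norm_num)
  refine ⟨φ, hφ, ?_⟩
  rwa [Matrix.trace_mul_comm, density, Matrix.mul_vecMulVec, Matrix.trace_vecMulVec,
    dotProduct_comm]

end MaxEntangled

/-! ### Maximally entangled ends force a correlation. -/

section Ends

variable {L : ℕ}

theorem norm_one_le : ‖(1 : Op (Fin L))‖ ≤ 2 ^ L := by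
  have h1 : ‖(1 : Op (Fin L))‖ ^ 2 = 2 ^ L := by
    have h := inner_self_eq (1 : Op (Fin L))
    rw [inner_eq_trace, star_one, one_mul, Matrix.trace_one] at h
    have h2 : (Fintype.card (Config (Fin L)) : ℝ) = ‖(1 : Op (Fin L))‖ ^ 2 := by exact_mod_cast h
    rw [← h2]
    simp
  have h2 : (1 : ℝ) ≤ 2 ^ L := one_le_pow₀ (by norm_num)
  exact abs_le_of_sq_le_sq' (by rw [h1]; nlinarith) (by positivity) |>.2

theorem le_norm_corr_of_singletFraction (hL : 2 ≤ L) {ψ : StateVec (Fin L)}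
    (hψ : ‖density ψ‖ = 1) (h : singletFraction (partialTrace (ends hL) (density ψ)) = 1) :
    1 / 4 ≤ 2 ^ L * ‖condExp (localAlg (outer L 1)) (corr (leftHalf L) (density ψ))‖ := by
  obtain ⟨φ, hφ, hφ1⟩ := exists_isMaxEntangled_of_singletFraction h
  have hf : Function.Injective (ends hL) := by
    intro a b hab
    have := congrArg Fin.val hab
    fin_cases a <;> fin_cases b <;> simp_all [ends] <;> omega
  have h0 : (⟨0, by omega⟩ : Fin L) ∈ leftHalf L := by
    simp only [leftHalf, Set.mem_ofPred_eq]
    omega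
  have h1 : (⟨L - 1, by omega⟩ : Fin L) ∈ (leftHalf L)ᶜ := by
    simp only [leftHalf, Set.mem_compl_iff, Set.mem_ofPred_eq]
    omega
  have hr : Set.range (ends hL) ⊆ outer L 1 := by
    rintro _ ⟨a, rfl⟩
    fin_cases a <;> (simp [ends, outer]; try omega)
  -- The witness |φ⟩⟨φ| ⊗ 1 has expectation above 3/4 in ρ and at most 1/2 in the product of its
  -- marginals; it lives on the end sites, so it sees only the projected correlation.
  set X := embedOp (ends hL) (density φ) with hX
  have hXs : star X = X := by rw [hX, star_embedOp, star_density]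
  have hXm : X ∈ localAlg (outer L 1) := embedOp_mem_localAlg hf hr _
  have hXn : ‖X‖ ≤ 2 ^ L := by
    have := norm_embedOp_mul_le hf (density φ) (1 : Op (Fin L))
    rw [mul_one, hφ.norm_density_eq_one, one_mul] at this
    exact this.trans norm_one_le
  have h2 := trace_embedOp_pair_mul_corr h0 h1 (density φ) (density ψ)
  have h3 := hφ.norm_sum_le (norm_siteExp_le (⟨0, by omega⟩ : Fin L) hψ)
    (norm_siteExp_le (⟨L - 1, by omega⟩ : Fin L) hψ)
  change (X * corr (leftHalf L) (density ψ)).trace = (X * density ψ).trace - _ at h2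
  rw [← trace_embedOp_mul] at hφ1
  have h4 := inner_condExp hXm (corr (leftHalf L) (density ψ))
  rw [inner_eq_trace X (corr _ _), hXs, h2] at h4
  have h5 := congrArg Complex.re h4
  rw [Complex.sub_re] at h5
  have h6 := (Complex.re_le_norm _).trans h3
  have h7 := (Complex.re_le_norm _).trans (norm_inner_le_norm (𝕜 := ℂ) X
    (condExp (localAlg (outer L 1)) (corr (leftHalf L) (density ψ))))
  have h8 : ‖X‖ * ‖condExp (localAlg (outer L 1)) (corr (leftHalf L) (density ψ))‖ ≤
      2 ^ L * ‖condExp (localAlg (outer L 1)) (corr (leftHalf L) (density ψ))‖ := by gcongr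
  linarith

end Ends

/-! ### Numerical estimate and conclusion. -/

theorem bound_lt_quarter {L j : ℕ} {T : ℝ} (hT : 0 ≤ T) (hj : 270400 ≤ j + 1)
    (hL : L ≤ 2 * j + 3) (hTj : T ≤ Real.sqrt (j + 1)) :
    2 ^ L * ((1 + 2 ^ L) * ((8 * T) ^ j / j.factorial)) < 1 / 4 := by
  set r := Real.sqrt (j + 1) with hr
  have hr2 : r ^ 2 = j + 1 := Real.sq_sqrt (by positivity)
  have hr520 : 520 ≤ r := by
    refine Real.le_sqrt_of_sq_le ?_
    have : ((270400 : ℕ) : ℝ) ≤ ((j + 1 : ℕ) : ℝ) := Nat.cast_le.2 hj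
    push_cast at this
    linarith
  -- The factor 64 = 16 · 4 is chosen so that 16^j absorbs the powers of 2^L and 4^j remains. Since
  -- (8T)^j · 64^j / j! ≤ exp(512 T), it suffices that j exceed 512 r + 9: then 4^j ≥ e^j wins, with
  -- e⁹ ≥ 512 = 4 · 128 for the constants. The threshold 270400 is 520².
  have hrj : 512 * r + 9 < j := by
    have : 520 * r ≤ r * r := mul_le_mul_of_nonneg_right hr520 (Real.sqrt_nonneg _)
    linarith
  have h1 : (8 * T) ^ j / j.factorial ≤ Real.exp (512 * r) / 64 ^ j := by
    rw [le_div_iff₀ (by positivity)]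
    calc (8 * T) ^ j / j.factorial * 64 ^ j = (512 * T) ^ j / j.factorial := by
          rw [div_mul_eq_mul_div, ← mul_pow]
          ring_nf
      _ ≤ Real.exp (512 * T) := Real.pow_div_factorial_le_exp _ (by positivity) _
      _ ≤ Real.exp (512 * r) := by gcongr
  have h2 : (2 : ℝ) ^ L * (1 + 2 ^ L) ≤ 128 * 16 ^ j := by
    have h3 : (2 : ℝ) ^ L ≤ 2 ^ (2 * j + 3) := pow_le_pow_right₀ (by norm_num) hL
    have h4 : (2 : ℝ) ^ (2 * j + 3) = 8 * 4 ^ j := by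
      rw [pow_add, pow_mul]
      norm_num
      ring
    have h5 : (16 : ℝ) ^ j = 4 ^ j * 4 ^ j := by
      rw [← mul_pow]
      norm_num
    have h6 : (1 : ℝ) ≤ 2 ^ L := one_le_pow₀ (by norm_num)
    rw [h4] at h3
    calc (2 : ℝ) ^ L * (1 + 2 ^ L) ≤ 2 ^ L * (2 ^ L + 2 ^ L) := by gcongr
      _ = 2 * (2 ^ L * 2 ^ L) := by ring
      _ ≤ 2 * (8 * 4 ^ j * (8 * 4 ^ j)) := by gcongr
      _ = 128 * 16 ^ j := by rw [h5]; ring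
  have h3 : Real.exp (512 * r) * 512 < 4 ^ j := by
    have h4 : (512 : ℝ) ≤ Real.exp 9 := by
      have h := Real.exp_one_gt_d9
      have h' : Real.exp 9 = Real.exp 1 ^ 9 := by
        rw [← Real.exp_nat_mul]
        norm_num
      rw [h']
      calc (512 : ℝ) = 2 ^ 9 := by norm_num
        _ ≤ _ := by gcongr; linarith
    have h5 : Real.exp j ≤ 4 ^ j := by
      rw [← mul_one (j : ℝ), Real.exp_nat_mul]
      have := Real.exp_one_lt_d9
      gcongr
      linarith
    calc Real.exp (512 * r) * 512 ≤ Real.exp (512 * r) * Real.exp 9 := by gcongr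
      _ = Real.exp (512 * r + 9) := (Real.exp_add _ _).symm
      _ < Real.exp j := Real.exp_lt_exp.2 hrj
      _ ≤ 4 ^ j := h5
  calc 2 ^ L * ((1 + 2 ^ L) * ((8 * T) ^ j / j.factorial))
      = 2 ^ L * (1 + 2 ^ L) * ((8 * T) ^ j / j.factorial) := by ring
    _ ≤ 128 * 16 ^ j * (Real.exp (512 * r) / 64 ^ j) := by gcongr
    _ = 128 * Real.exp (512 * r) / 4 ^ j := by
        have : (64 : ℝ) ^ j = 16 ^ j * 4 ^ j := by
          rw [← mul_pow]
          norm_num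
        rw [this]
        field_simp
    _ < 1 / 4 := by
        rw [div_lt_iff₀ (by positivity)]
        linarith

end QubitChain

end

theorem mainTheorem4 :
    ∃ L₀ : ℕ, ∀ (L : ℕ) (hL : 2 ≤ L), L₀ ≤ L →
      ∀ (T : ℝ), 0 ≤ T →
      ∀ (K : Fin L → ℝ → QubitChain.Op (Fin 1)) (h : Fin (L - 1) → ℝ → QubitChain.Op (Fin 2))
        (ψ : ℝ → QubitChain.StateVec (Fin L)),
        QubitChain.IsUnitChainEvolution L T K h ψ →
        QubitChain.IsProductState (ψ 0) →
        QubitChain.singletFraction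
          (QubitChain.partialTrace (QubitChain.ends hL) (QubitChain.density (ψ T))) = 1 →
        Real.sqrt (((L / 2 : ℕ) : ℝ) / 2) ≤ T := by
  -- This is 2 · 270400, so that `L / 2`, which is `j + 1`, reaches the numerical threshold.
  refine ⟨540800, fun L hL hL0 T hT K h ψ ev hψ hF => ?_⟩
  by_contra! hlt
  obtain ⟨j, hj⟩ : ∃ j, L / 2 = j + 1 := ⟨L / 2 - 1, by omega⟩
  have hTmem : T ∈ Set.Icc 0 T := ⟨hT, le_rfl⟩
  have h1 := QubitChain.le_norm_corr_of_singletFraction hL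
    (ev.norm_density_eq_one hψ hTmem) hF
  have h2 := ev.norm_corr_outer_le hψ j (by omega) T hTmem
  have hsub : L / 2 - j = 1 := by omega
  rw [hsub] at h2
  -- The factor 1/2 under the root is simply discarded; the estimate has room to spare.
  have hTj : T ≤ Real.sqrt (j + 1) := by
    refine hlt.le.trans (Real.sqrt_le_sqrt ?_)
    rw [hj]
    push_cast
    linarith [(Nat.cast_nonneg j : (0 : ℝ) ≤ j)]
  have h3 := QubitChain.bound_lt_quarter (L := L) hT (by omega) (by omega) hTj
  have h4 := mul_le_mul_of_nonneg_left h2 (by positivity : (0 : ℝ) ≤ 2 ^ L)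
  linarith
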